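/- Let $n\ge 1$ be an integer, let $b_1,b_2:[0,\infty)\to[0,\infty)$ be continuous and integrable, and let $p,q>1$ satisfy $$\max\Big\{\frac{q+1+p^{-1}}{pq-1},\ \frac{2+q^{-1}}{pq-1}\Big\}>\frac{n-1}{2}.$$ Let $R>0$, let $u_0,v_0\in H^1(\mathbb R^n)$ and $u_1,v_1\in L^2(\mathbb R^n)$ be nonnegative and supported in the ball $\{|x|\le R\}$, with $u_1\not\equiv 0$ and $v_0\not\equiv 0$. For $\varepsilon>0$ consider the Cauchy problem $$\begin{cases}u_{tt}-\Delta u+b_1(t)u_t=|v|^q, & x\in\mathbb R^n,\ t>0,\\ v_{tt}-\Delta v+b_2(t)v_t=|\partial_t u|^p, & x\in\mathbb R^n,\ t>0,\\ (u,u_t,v,v_t)(0,x)=\varepsilon\,(u_0,u_1,v_0,v_1)(x), & x\in\mathbb R^n.\end{cases}$$ For $T\in(0,\infty]$, an energy solution on $[0,T)$ is a pair $(u,v)$ with $u,v\in C([0,T),H^1(\mathbb R^n))\cap C^1([0,T),L^2(\mathbb R^n))$, $\partial_tu\in L^p_{\rm loc}([0,T)\times\mathbb R^n)$, $v\in L^q_{\rm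 loc}([0,T)\times\mathbb R^n)$, $u(0)=\varepsilon u_0$ and $v(0)=\varepsilon v_0$ in $H^1(\mathbb R^n)$, such that for all $\phi\in C_0^\infty([0,T)\times\mathbb R^n)$ and all $t\in[0,T)$ $$\int_{\mathbb R^n}\partial_tu(t,x)\phi(t,x)\,dx-\int_{\mathbb R^n}\varepsilon u_1(x)\phi(0,x)\,dx+\int_0^t\!\int_{\mathbb R^n}\big(-\partial_tu\,\phi_s+\nabla u\cdot\nabla\phi+b_1(s)\,\partial_tu\,\phi\big)(s,x)\,dx\,ds=\int_0^t\!\int_{\mathbb R^n}|v(s,x)|^q\phi(s,x)\,dx\,ds,$$ and the same identity holds with $(u,u_1,b_1,|v|^q)$ replaced by $(v,v_1,b_2,|\partial_tu|^p)$. Then there exist constants $\varepsilon_0>0$ and $C>0$, depending only on $n,p,q,b_1,b_2,R,u_0,u_1,v_0,v_1$, such that for every $0<\varepsilon\le\varepsilon_0$, every $T\in(0,\infty]$ and every energy solution $(u,v)$ on $[0,T)$ with $$\operatorname{supp}u,\ \operatorname{supp}v\subset\{(t,x)\in[0,T)\times\mathbb R^n:\ |x|\le t+R\},$$ one has $T<\infty$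 (so the solution blows up in finite time, in the sense that its lifespan is finite), and $$T\le C\,\varepsilon^{-1/\max\{\Theta_1,\Theta_2\}},\qquad \Theta_1=\frac{q+1+p^{-1}}{pq-1}-\frac{n-1}{2},\quad \Theta_2=\frac{2+q^{-1}}{pq-1}-\frac{n-1}{2}.$$ In particular the lifespan $T(\varepsilon)$ of the solution satisfies this bound. -/

import Mathlib

open MeasureTheory Set
open scoped ContDiff ENNReal

noncomputable section

namespace DampedWave

/-- The real space `L²(ℝⁿ)`. -/
abbrev L2 (n : ℕ) : Type := Lp ℝ 2 (volume : Measure (EuclideanSpace ℝ (Fin n)))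

/-- The space `L²(ℝⁿ; ℝⁿ)` of square integrable vector fields. -/
abbrev L2Vec (n : ℕ) : Type :=
  Lp (EuclideanSpace ℝ (Fin n)) 2 (volume : Measure (EuclideanSpace ℝ (Fin n)))

/-- `g` is the weak (distributional) gradient of `f` on `ℝⁿ`. -/
def HasWeakGradient {n : ℕ} (f : L2 n) (g : L2Vec n) : Prop :=
  ∀ φ : EuclideanSpace ℝ (Fin n) → ℝ, ContDiff ℝ ∞ φ → HasCompactSupport φ →
    ∫ x, f x • gradient φ x = -∫ x, φ x • g x

theorem continuous_gradient {n : ℕ} {φ : EuclideanSpace ℝ (Fin n) → ℝ}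
    (hφ : ContDiff ℝ ∞ φ) : Continuous (gradient φ) :=
  (InnerProductSpace.toDual ℝ (EuclideanSpace ℝ (Fin n))).symm.continuous.comp
    (hφ.continuous_fderiv (by simp))

theorem hasCompactSupport_gradient {n : ℕ} {φ : EuclideanSpace ℝ (Fin n) → ℝ}
    (hφ : HasCompactSupport φ) : HasCompactSupport (gradient φ) :=
  (hφ.fderiv (𝕜 := ℝ)).comp_left
    (g := (InnerProductSpace.toDual ℝ (EuclideanSpace ℝ (Fin n))).symm) (map_zero _)

theorem integrable_smul_gradient {n : ℕ} (f : L2 n) {φ : EuclideanSpace ℝ (Fin n) → ℝ}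
    (hφ : ContDiff ℝ ∞ φ) (hc : HasCompactSupport φ) :
    Integrable (fun x => f x • gradient φ x) :=
  ((Lp.memLp f).locallyIntegrable (by norm_num)).integrable_smul_right_of_hasCompactSupport
    (continuous_gradient hφ) (hasCompactSupport_gradient hc)

theorem integrable_smul_vec {n : ℕ} (g : L2Vec n) {φ : EuclideanSpace ℝ (Fin n) → ℝ}
    (hφ : ContDiff ℝ ∞ φ) (hc : HasCompactSupport φ) :
    Integrable (fun x => φ x • g x) :=
  ((Lp.memLp g).locallyIntegrable (by norm_num)).integrable_smul_left_of_hasCompactSupport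
    hφ.continuous hc

theorem HasWeakGradient.add {n : ℕ} {f f' : L2 n} {g g' : L2Vec n}
    (h : HasWeakGradient f g) (h' : HasWeakGradient f' g') :
    HasWeakGradient (f + f') (g + g') := by
  intro φ hφ hc
  have e1 : ∫ x, (f + f') x • gradient φ x
      = ∫ x, (f x • gradient φ x + f' x • gradient φ x) := by
    apply integral_congr_ae
    filter_upwards [Lp.coeFn_add f f'] with x hx
    rw [hx, Pi.add_apply, add_smul]
  have e2 : ∫ x, φ x • (g + g') x = ∫ x, (φ x • g x + φ x • g' x) := by
    apply integral_congr_ae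
    filter_upwards [Lp.coeFn_add g g'] with x hx
    rw [hx, Pi.add_apply, smul_add]
  rw [e1, e2, integral_add (integrable_smul_gradient f hφ hc) (integrable_smul_gradient f' hφ hc),
    integral_add (integrable_smul_vec g hφ hc) (integrable_smul_vec g' hφ hc),
    h φ hφ hc, h' φ hφ hc, neg_add]

theorem HasWeakGradient.smul {n : ℕ} {f : L2 n} {g : L2Vec n} (c : ℝ)
    (h : HasWeakGradient f g) : HasWeakGradient (c • f) (c • g) := by
  intro φ hφ hc
  have e1 : ∫ x, (c • f) x • gradient φ x = ∫ x, c • (f x • gradient φ x) := by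
    apply integral_congr_ae
    filter_upwards [Lp.coeFn_smul c f] with x hx
    rw [hx, Pi.smul_apply, smul_assoc]
  have e2 : ∫ x, φ x • (c • g) x = ∫ x, c • (φ x • g x) := by
    apply integral_congr_ae
    filter_upwards [Lp.coeFn_smul c g] with x hx
    rw [hx, Pi.smul_apply, smul_comm]
  rw [e1, e2, integral_smul, integral_smul, h φ hφ hc, smul_neg]

theorem HasWeakGradient.zero {n : ℕ} : HasWeakGradient (0 : L2 n) (0 : L2Vec n) := by
  intro φ hφ hc
  have h0 := Lp.coeFn_zero ℝ 2 (volume : Measure (EuclideanSpace ℝ (Fin n)))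
  have h0' := Lp.coeFn_zero (EuclideanSpace ℝ (Fin n)) 2
    (volume : Measure (EuclideanSpace ℝ (Fin n)))
  have e1 : ∫ x, (0 : L2 n) x • gradient φ x = 0 := by
    apply integral_eq_zero_of_ae
    filter_upwards [h0] with x hx
    rw [hx]; simp
  have e2 : ∫ x, φ x • (0 : L2Vec n) x = 0 := by
    apply integral_eq_zero_of_ae
    filter_upwards [h0'] with x hx
    rw [hx]; simp
  rw [e1, e2, neg_zero]

/-- The Sobolev space `H¹(ℝⁿ)`: pairs `(f, ∇f)` of an `L²` function and its weak gradient
(unique if it exists) in `L²`, with the norm `(‖f‖² + ‖∇f‖²)^{1/2}`. -/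
def H1 (n : ℕ) : Submodule ℝ (WithLp 2 (L2 n × L2Vec n)) where
  carrier := {w | HasWeakGradient w.fst w.snd}
  add_mem' := fun h h' => HasWeakGradient.add h h'
  zero_mem' := HasWeakGradient.zero
  smul_mem' := fun c _ h => HasWeakGradient.smul c h

/-- The `L²` function underlying an element of `H¹`. -/
def H1.toL2 {n : ℕ} (w : H1 n) : L2 n := w.1.fst

/-- The weak gradient of an element of `H¹`. -/
def H1.grad {n : ℕ} (w : H1 n) : L2Vec n := w.1.snd

/-- The time interval `[0, T)`, where `T` may be `∞`. -/
def timeInterval (T : EReal) : Set ℝ := {t | 0 ≤ t ∧ (t : EReal) < T}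

/-- `u ∈ C([0,T), H¹) ∩ C¹([0,T), L²)` with time derivative `ut`. -/
structure IsEnergyCurve {n : ℕ} (T : EReal) (u : ℝ → H1 n) (ut : ℝ → L2 n) : Prop where
  continuousOn : ContinuousOn u (timeInterval T)
  hasDeriv : ∀ t ∈ timeInterval T,
    HasDerivWithinAt (fun s => H1.toL2 (u s)) (ut t) (timeInterval T) t
  continuousOn_deriv : ContinuousOn ut (timeInterval T)

/-- The curve `w : [0,T) → L²(ℝⁿ)`, viewed as a function on space-time, belongs to
`L^r_loc([0,T) × ℝⁿ)`. -/
def MemLrLoc {n : ℕ} (T : EReal) (r : ℝ) (w : ℝ → L2 n) : Prop :=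
  ∃ W : ℝ × EuclideanSpace ℝ (Fin n) → ℝ,
    (∀ᵐ t : ℝ, t ∈ timeInterval T → ∀ᵐ x, W (t, x) = w t x) ∧
    ∀ K : Set (ℝ × EuclideanSpace ℝ (Fin n)), IsCompact K → K ⊆ timeInterval T ×ˢ univ →
      MemLp W (ENNReal.ofReal r) (volume.restrict K)

/-- Test functions in `C₀^∞([0,T) × ℝⁿ)` (smooth up to `t = 0`, where they need not vanish),
given through an extension to negative times. -/
structure IsTestFunction {n : ℕ} (T : EReal) (φ : ℝ × EuclideanSpace ℝ (Fin n) → ℝ) : Prop where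
  smooth : ContDiff ℝ ∞ φ
  hasCompactSupport : HasCompactSupport φ
  support_lt : ∀ z ∈ tsupport φ, (z.1 : EReal) < T

/-- The integral identity for `w_tt - Δw + b(t) w_t = |f|^r` on `[0,T)` with `w_t(0) = w1`;
here `wt` is the time derivative of `w`. -/
def WeakIdentity {n : ℕ} (T : EReal) (b : ℝ → ℝ) (r : ℝ) (w1 : L2 n)
    (w : ℝ → H1 n) (wt f : ℝ → L2 n) : Prop :=
  ∀ φ : ℝ × EuclideanSpace ℝ (Fin n) → ℝ, IsTestFunction T φ → ∀ t ∈ timeInterval T,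
    (∫ x, wt t x * φ (t, x)) - (∫ x, w1 x * φ (0, x))
      - (∫ s in (0 : ℝ)..t, ∫ x, wt s x * deriv (fun τ => φ (τ, x)) s)
      + (∫ s in (0 : ℝ)..t, ∫ x, inner ℝ (H1.grad (w s) x) (gradient (fun y => φ (s, y)) x))
      + (∫ s in (0 : ℝ)..t, ∫ x, b s * wt s x * φ (s, x))
    = ∫ s in (0 : ℝ)..t, ∫ x, |f s x| ^ r * φ (s, x)

/-- `(u, v)` is an energy solution on `[0,T)` of
`u_tt - Δu + b₁(t) u_t = |v|^q`, `v_tt - Δv + b₂(t) v_t = |u_t|^p`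
with data `(u, u_t, v, v_t)(0) = ε (u₀, u₁, v₀, v₁)`. -/
def IsEnergySolution {n : ℕ} (p q : ℝ) (b₁ b₂ : ℝ → ℝ) (ε : ℝ)
    (u₀ : H1 n) (u₁ : L2 n) (v₀ : H1 n) (v₁ : L2 n) (T : EReal) (u v : ℝ → H1 n) : Prop :=
  ∃ ut vt : ℝ → L2 n,
    IsEnergyCurve T u ut ∧ IsEnergyCurve T v vt ∧
    MemLrLoc T p ut ∧ MemLrLoc T q (fun t => H1.toL2 (v t)) ∧
    u 0 = ε • u₀ ∧ v 0 = ε • v₀ ∧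
    WeakIdentity T b₁ q (ε • u₁) u ut (fun t => H1.toL2 (v t)) ∧
    WeakIdentity T b₂ p (ε • v₁) v vt ut

/-- `f` vanishes almost everywhere outside the ball of radius `r` around the origin. -/
def SupportedInBall {n : ℕ} (r : ℝ) (f : L2 n) : Prop :=
  ∀ᵐ x, r < ‖x‖ → f x = 0

/-- `f ≥ 0` almost everywhere. -/
def Nonneg {n : ℕ} (f : L2 n) : Prop := ∀ᵐ x, 0 ≤ f x

/-- `Θ₁(n,p,q)`. -/
def Theta1 (n : ℕ) (p q : ℝ) : ℝ := (q + 1 + p⁻¹) / (p * q - 1) - ((n : ℝ) - 1) / 2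

/-- `Θ₂(n,p,q)`. -/
def Theta2 (n : ℕ) (p q : ℝ) : ℝ := (2 + q⁻¹) / (p * q - 1) - ((n : ℝ) - 1) / 2

end DampedWave

end

namespace DampedWave

/-! ### Scalar differential inequalities -/

/-! Fix a real time `T'` below the lifespan and write `T` for it. Finite propagation speed makes it
legitimate to test both equations with functions of `x` that are not compactly supported, since a
cutoff equal to one on the support of the solution is invisible.

Testing with `1` gives ordinary differential inequalities for `A = ∫ ∂ₜu` and `V = ∫ v`. The damping
only contributes the integrating factor `exp (∫ b)`, which lies between two positive constants
because `b` is nonnegative and integrable. Thus `A ≥ c ∫ Nq` and `V ≥ c ∬ Np`, while Hölder on the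
ball of radius `T + R` gives `Np ≥ c T^(-n(p-1)) |A|^p`, and similarly for `Nq`. Composing the two,
a bound `A ≥ α` on a final time interval improves to one of order `α^(pq)` on a slightly shorter
interval. Iterating over dyadically shrinking slices (`slice_bound`) forces divergence unless
`T^(2q+1-n(pq-1)) α₀^(pq-1)` is bounded, where `α₀` is any lower bound for `A` on `[T/2, T]`
(`AveragedSystem.bound_of_initial`).

The starting bound comes from testing with `exp (ξ·x)` for `1 ≤ |ξ| ≤ 2`. The pairings with `∂ₜu`
and `v` grow like `ε exp (|ξ| t)` (`exp_growth`). Superposing over `ξ` with the factor `exp (-|ξ|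
τ)`, `τ = t + R`, produces a weight of size `τ^(-(n-1)/2)` concentrated in a layer of bounded
thickness at the light cone (`waveWeight_le`). Hölder against that weight yields `Np ≥ c ε^p
T^((n-1)(1-p/2))`, and likewise for `Nq` (`exists_powerPairing_ge_wave`).

Starting the iteration from the bound on `Nq` gives the exponent `Θ₂`
(`AveragedSystem.lifespan_two`). Starting from the bound on `Np`, passed once through the second
equation, gives `Θ₁` (`AveragedSystem.lifespan_one`). -/

theorem hasDerivAt_primitive {f : ℝ → ℝ} (hf : Continuous f) (a t : ℝ) :
    HasDerivAt (fun s => ∫ x in a..s, f x) (f t) t :=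
  (hf.integral_hasStrictDerivAt a t).hasDerivAt

/-- The integrating factor `exp (∫₀ᵗ b)`. -/
noncomputable def factor (b : ℝ → ℝ) (t : ℝ) : ℝ := Real.exp (∫ s in (0 : ℝ)..t, b s)

theorem factor_pos (b : ℝ → ℝ) (t : ℝ) : 0 < factor b t := Real.exp_pos _

theorem factor_zero (b : ℝ → ℝ) : factor b 0 = 1 := by simp [factor]

theorem hasDerivAt_factor {b : ℝ → ℝ} (hb : Continuous b) (t : ℝ) :
    HasDerivAt (factor b) (factor b t * b t) t :=
  (hasDerivAt_primitive hb 0 t).exp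

theorem continuous_factor {b : ℝ → ℝ} (hb : Continuous b) : Continuous (factor b) :=
  continuous_iff_continuousAt.2 fun t => (hasDerivAt_factor hb t).continuousAt

theorem factor_mono {b : ℝ → ℝ} (hb : Continuous b) (hb0 : ∀ t, 0 ≤ b t) : Monotone (factor b) :=
  monotone_of_hasDerivAt_nonneg (hasDerivAt_factor hb)
    fun t => mul_nonneg (factor_pos b t).le (hb0 t)

theorem one_le_factor {b : ℝ → ℝ} (hb : Continuous b) (hb0 : ∀ t, 0 ≤ b t) {t : ℝ} (ht : 0 ≤ t) :
    1 ≤ factor b t := by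
  simpa [factor_zero] using factor_mono hb hb0 ht

/-- Variation of constants for `P' + b P = κ Y + N`, as an inequality for nonnegative `N`. -/
theorem factor_mul_ge {b P Y N : ℝ → ℝ} {κ T : ℝ} (hb : Continuous b) (hb0 : ∀ t, 0 ≤ b t)
    (hP : Continuous P) (hY : Continuous Y) (hN : IntervalIntegrable N volume 0 T)
    (hN0 : ∀ t, 0 ≤ N t)
    (heq : ∀ t ∈ Icc 0 T, P t = P 0 + κ * (∫ s in (0 : ℝ)..t, Y s)
      - (∫ s in (0 : ℝ)..t, b s * P s) + ∫ s in (0 : ℝ)..t, N s)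
    {t : ℝ} (ht : t ∈ Icc 0 T) :
    P 0 + κ * (∫ s in (0 : ℝ)..t, factor b s * Y s) + (∫ s in (0 : ℝ)..t, N s)
      ≤ factor b t * P t := by
  -- `N` is merely integrable, so `P` need not be differentiable everywhere. Subtracting `∫ N`
  -- leaves the C¹ function `H`, to which the integrating factor is applied.
  set H : ℝ → ℝ := fun t => P 0 + κ * (∫ s in (0 : ℝ)..t, Y s) - (∫ s in (0 : ℝ)..t, b s * P s)
    with hH
  have hm := continuous_factor hb
  have dH : ∀ t, HasDerivAt H (κ * Y t - b t * P t) t := fun t =>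
    (((hasDerivAt_primitive hY 0 t).const_mul κ).const_add (P 0)).sub
      (hasDerivAt_primitive (hb.mul hP) 0 t)
  have hHc : Continuous H := continuous_iff_continuousAt.2 fun t => (dH t).continuousAt
  have dmH : ∀ t, HasDerivAt (fun t => factor b t * H t)
      (κ * (factor b t * Y t) - factor b t * b t * (P t - H t)) t := fun t => by
    refine ((hasDerivAt_factor hb t).mul (dH t)).congr_deriv ?_
    ring
  have hc1 : Continuous fun t => κ * (factor b t * Y t) := by fun_prop
  have hc2 : Continuous fun t => factor b t * b t * (P t - H t) := by fun_prop
  have hc3 : Continuous fun t => factor b t * b t := by fun_prop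
  have e1 := intervalIntegral.integral_eq_sub_of_hasDerivAt (a := 0) (b := t)
    (fun s _ => dmH s) ((hc1.sub hc2).intervalIntegrable _ _)
  rw [intervalIntegral.integral_sub (hc1.intervalIntegrable _ _) (hc2.intervalIntegrable _ _),
    intervalIntegral.integral_const_mul] at e1
  have e2 := intervalIntegral.integral_eq_sub_of_hasDerivAt (a := 0) (b := t)
    (fun s _ => hasDerivAt_factor hb s) (hc3.intervalIntegrable _ _)
  have hH0 : H 0 = P 0 := by simp [hH]
  -- On `[0, t]` the difference `P - H = ∫ N` is nondecreasing, so it is replaced by its final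
  -- value; what remains integrates to `factor b t - 1`.
  have key : (∫ s in (0 : ℝ)..t, factor b s * b s * (P s - H s))
      ≤ ∫ s in (0 : ℝ)..t, factor b s * b s * (P t - H t) := by
    apply intervalIntegral.integral_mono_on ht.1 (hc2.intervalIntegrable _ _)
      ((hc3.mul continuous_const).intervalIntegrable _ _)
    intro s hs
    have hs' : s ∈ Icc 0 T := ⟨hs.1, hs.2.trans ht.2⟩
    have i1 : P s - H s = ∫ s in (0 : ℝ)..s, N s := by rw [heq s hs']; simp [hH]
    have i2 : P t - H t = ∫ s in (0 : ℝ)..t, N s := by rw [heq t ht]; simp [hH]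
    rw [i1, i2]
    apply mul_le_mul_of_nonneg_left _ (mul_nonneg (factor_pos b s).le (hb0 s))
    apply intervalIntegral.integral_mono_interval le_rfl hs.1 hs.2
      (Filter.Eventually.of_forall hN0)
    exact hN.mono_set (by rw [uIcc_of_le ht.1, uIcc_of_le (ht.1.trans ht.2)]
                          exact Icc_subset_Icc_right ht.2)
  rw [intervalIntegral.integral_mul_const, e2] at key
  have i2 : P t - H t = ∫ s in (0 : ℝ)..t, N s := by rw [heq t ht]; simp [hH]
  rw [← i2]
  simp only [factor_zero, hH0] at e1 key
  nlinarith [e1, key]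

/-- Grönwall: `exp (-K t) ∫₀ᵗ f` is nonincreasing and starts at zero. -/
theorem nonpos_of_le_mul_integral {f : ℝ → ℝ} {K T : ℝ} (hf : Continuous f) (hf0 : ∀ t, 0 ≤ f t)
    (h : ∀ t ∈ Icc 0 T, f t ≤ K * ∫ s in (0 : ℝ)..t, f s) {t : ℝ} (ht : t ∈ Icc 0 T) :
    f t ≤ 0 := by
  set G : ℝ → ℝ := fun t => ∫ s in (0 : ℝ)..t, f s with hG
  have dG : ∀ t, HasDerivAt G (f t) t := hasDerivAt_primitive hf 0
  have d : ∀ t, HasDerivAt (fun t => Real.exp (-(K * t)) * G t)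
      (Real.exp (-(K * t)) * (f t - K * G t)) t := fun t => by
    have h1 : HasDerivAt (fun t => Real.exp (-(K * t))) (Real.exp (-(K * t)) * -(K * 1)) t :=
      ((hasDerivAt_id t).const_mul K).neg.exp
    refine (h1.mul (dG t)).congr_deriv ?_
    ring
  have anti : AntitoneOn (fun t => Real.exp (-(K * t)) * G t) (Icc 0 T) := by
    apply antitoneOn_of_deriv_nonpos (convex_Icc _ _)
      (fun s _ => (d s).continuousAt.continuousWithinAt)
      (fun s _ => (d s).differentiableAt.differentiableWithinAt)
    intro s hs
    rw [(d s).deriv]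
    exact mul_nonpos_of_nonneg_of_nonpos (Real.exp_pos _).le
      (by linarith [h s (interior_subset hs)])
  have h0 := anti ⟨le_rfl, ht.1.trans ht.2⟩ ht ht.1
  have hG0 : G 0 = 0 := by simp [hG]
  simp only [hG0, mul_zero] at h0
  have hGt : G t = 0 := le_antisymm (by
    by_contra hc
    push Not at hc
    linarith [mul_pos (Real.exp_pos (-(K * t))) hc])
    (intervalIntegral.integral_nonneg ht.1 fun s _ => hf0 s)
  have := h t ht
  rwa [show (∫ s in (0 : ℝ)..t, f s) = G t from rfl, hGt, mul_zero] at this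

/-- Grönwall applied to the negative part of `Y`. Monotonicity of the integrating factor bounds the
velocity below by `-κ` times the integral of the negative part, and one more integration closes the
loop. -/
theorem position_nonneg {b P Y : ℝ → ℝ} {κ T : ℝ} (hκ : 0 ≤ κ) (hb : Continuous b)
    (hb0 : ∀ t, 0 ≤ b t) (hP : Continuous P) (hY : ∀ t, HasDerivAt Y (P t) t)
    (hP0 : 0 ≤ P 0) (hY0 : 0 ≤ Y 0)
    (h : ∀ t ∈ Icc 0 T, P 0 + κ * (∫ s in (0 : ℝ)..t, factor b s * Y s) ≤ factor b t * P t)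
    {t : ℝ} (ht : t ∈ Icc 0 T) : 0 ≤ Y t := by
  have hYc : Continuous Y := continuous_iff_continuousAt.2 fun t => (hY t).continuousAt
  have hm := continuous_factor hb
  set f : ℝ → ℝ := fun t => max (-(Y t)) 0 with hf
  have hfc : Continuous f := by fun_prop
  have hf0 : ∀ t, 0 ≤ f t := fun t => le_max_right _ _
  have hPlow : ∀ s ∈ Icc 0 T, -(κ * ∫ r in (0 : ℝ)..s, f r) ≤ P s := by
    intro s hs
    have h1 : (∫ r in (0 : ℝ)..s, factor b s * -(f r)) ≤ ∫ r in (0 : ℝ)..s, factor b r * Y r := by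
      apply intervalIntegral.integral_mono_on hs.1 (Continuous.intervalIntegrable (by fun_prop) _ _)
        (Continuous.intervalIntegrable (by fun_prop) _ _)
      intro r hr
      have h2 : -(Y r) ≤ f r := le_max_left _ _
      have h3 := factor_mono hb hb0 hr.2
      nlinarith [hf0 r, factor_pos b r]
    rw [intervalIntegral.integral_const_mul, intervalIntegral.integral_neg] at h1
    have h2 := h s hs
    have h3 := mul_le_mul_of_nonneg_left h1 hκ
    have h4 : factor b s * -(κ * ∫ r in (0 : ℝ)..s, f r) ≤ factor b s * P s := by linarith
    exact le_of_mul_le_mul_left h4 (factor_pos b s)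
  have key : f t ≤ 0 := by
    apply nonpos_of_le_mul_integral (K := κ * T) (T := T) hfc hf0 _ ht
    intro s hs
    have hGs : 0 ≤ ∫ r in (0 : ℝ)..s, f r :=
      intervalIntegral.integral_nonneg hs.1 fun s _ => hf0 s
    apply max_le _ (mul_nonneg (mul_nonneg hκ (hs.1.trans hs.2)) hGs)
    have e := intervalIntegral.integral_eq_sub_of_hasDerivAt (a := 0) (b := s)
      (fun s _ => hY s) (hP.intervalIntegrable _ _)
    have h1 : (∫ r in (0 : ℝ)..s, -(κ * ∫ r in (0 : ℝ)..s, f r)) ≤ ∫ r in (0 : ℝ)..s, P r := by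
      apply intervalIntegral.integral_mono_on hs.1 (by simp) (hP.intervalIntegrable _ _)
      intro r hr
      refine le_trans ?_ (hPlow r ⟨hr.1, hr.2.trans hs.2⟩)
      apply neg_le_neg
      apply mul_le_mul_of_nonneg_left _ hκ
      exact intervalIntegral.integral_mono_interval le_rfl hr.1 hr.2
        (Filter.Eventually.of_forall hf0) (hfc.intervalIntegrable _ _)
    rw [intervalIntegral.integral_const, smul_eq_mul, sub_zero] at h1
    nlinarith [mul_nonneg hκ hGs, hs.2]
  have := le_max_left (-(Y t)) 0
  simp only [hf] at key
  linarith

/-- Exponential growth for the damped equation `Y'' + b Y' ≥ l² Y` with nonnegative data. -/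
theorem exp_growth {b P Y : ℝ → ℝ} {l T M : ℝ} (hl1 : 1 ≤ l) (hl2 : l ≤ 2) (hb : Continuous b)
    (hb0 : ∀ t, 0 ≤ b t) (hM : ∀ t, factor b t ≤ M) (hP : Continuous P)
    (hY : ∀ t, HasDerivAt Y (P t) t) (hP0 : 0 ≤ P 0) (hY0 : 0 ≤ Y 0)
    (h : ∀ t ∈ Icc 0 T, P 0 + l ^ 2 * (∫ s in (0 : ℝ)..t, factor b s * Y s) ≤ factor b t * P t)
    {t : ℝ} (ht2 : 2 ≤ t) (htT : t ≤ T) :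
    Real.exp (-2) / (8 * M ^ 2) * (P 0 + Y 0) * Real.exp (l * t) ≤ P t ∧
    Real.exp (-2) / (8 * M ^ 2) * (P 0 + Y 0) * Real.exp (l * t) ≤ Y t := by
  have hYc : Continuous Y := continuous_iff_continuousAt.2 fun t => (hY t).continuousAt
  have hm := continuous_factor hb
  have hYn : ∀ t ∈ Icc 0 T, 0 ≤ Y t := fun t ht =>
    position_nonneg (sq_nonneg l) hb hb0 hP hY hP0 hY0 h ht
  have hM1 : 1 ≤ M := (one_le_factor hb hb0 le_rfl).trans (hM 0)
  have hM0 : 0 < M := by linarith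
  have hl0 : 0 < l := by linarith
  set S0 := P 0 + Y 0 with hS0
  have hS0n : 0 ≤ S0 := by positivity
  set Q : ℝ → ℝ := fun t => P 0 + l ^ 2 * (∫ s in (0 : ℝ)..t, factor b s * Y s) with hQ
  have hQ0 : Q 0 = P 0 := by simp [hQ]
  have dQ : ∀ t, HasDerivAt Q (l ^ 2 * (factor b t * Y t)) t := fun t =>
    ((hasDerivAt_primitive (hm.mul hYc) 0 t).const_mul _).const_add _
  have dexp : ∀ c t : ℝ, HasDerivAt (fun t => Real.exp (c * t)) (Real.exp (c * t) * (c * 1)) t :=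
    fun c t => ((hasDerivAt_id t).const_mul c).exp
  -- The operator `∂ₜ² - l²` is factored as `(∂ₜ - l)(∂ₜ + l)`. Here `Q ≤ factor b · P` stands in
  -- for the weighted velocity, and the damping enters this derivative with a favourable sign
  -- because `Y ≥ 0`.
  have dS : ∀ t, HasDerivAt (fun t => Real.exp (-l * t) * (Q t + l * (factor b t * Y t)))
      (Real.exp (-l * t) * l * (factor b t * P t - Q t + factor b t * b t * Y t)) t := fun t => by
    refine ((dexp (-l) t).mul
      ((dQ t).add (((hasDerivAt_factor hb t).mul (hY t)).const_mul l))).congr_deriv ?_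
    simp only [Pi.add_apply, Pi.mul_apply]
    ring
  have monoS : MonotoneOn (fun t => Real.exp (-l * t) * (Q t + l * (factor b t * Y t)))
      (Icc 0 T) := by
    apply monotoneOn_of_deriv_nonneg (convex_Icc _ _)
      (fun s _ => (dS s).continuousAt.continuousWithinAt)
      (fun s _ => (dS s).differentiableAt.differentiableWithinAt)
    intro s hs
    rw [(dS s).deriv]
    have h1 := h s (interior_subset hs)
    have h2 := mul_nonneg (mul_nonneg (factor_pos b s).le (hb0 s)) (hYn s (interior_subset hs))
    exact mul_nonneg (by positivity) (by simp only [hQ]; linarith)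
  have hSlow : ∀ s ∈ Icc 0 T, S0 * Real.exp (l * s) ≤ Q s + l * (factor b s * Y s) := by
    intro s hs
    have h1 := monoS ⟨le_rfl, hs.1.trans hs.2⟩ hs hs.1
    simp only [mul_zero, Real.exp_zero, hQ0, factor_zero, one_mul] at h1
    have h2 : S0 ≤ Real.exp (-l * s) * (Q s + l * (factor b s * Y s)) := by
      rw [hS0]; nlinarith
    have h3 := mul_le_mul_of_nonneg_right h2 (Real.exp_pos (l * s)).le
    have h4 : Real.exp (-l * s) * Real.exp (l * s) = 1 := by rw [← Real.exp_add]; simp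
    calc _ ≤ _ := h3
      _ = (Real.exp (-l * s) * Real.exp (l * s)) * (Q s + l * (factor b s * Y s)) := by ring
      _ = _ := by rw [h4, one_mul]
  have hsum : ∀ s ∈ Icc 0 T, S0 / M * Real.exp (l * s) ≤ P s + l * Y s := by
    intro s hs
    have h1 := hSlow s hs
    have h2 := h s hs
    have h3 : S0 * Real.exp (l * s) ≤ factor b s * (P s + l * Y s) := by
      simp only [hQ] at h1
      linarith
    have h5 : 0 ≤ P s + l * Y s := by
      by_contra hc
      push Not at hc
      have : 0 ≤ S0 * Real.exp (l * s) := by positivity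
      nlinarith [factor_pos b s]
    have h6 : S0 * Real.exp (l * s) ≤ M * (P s + l * Y s) :=
      h3.trans (mul_le_mul_of_nonneg_right (hM s) h5)
    rw [div_mul_eq_mul_div, div_le_iff₀ hM0]
    linarith
  -- Second factor: `P + l Y ≥ (S0/M) exp (l t)` says that `exp (l t) Y` grows at least as fast as a
  -- primitive of `(S0/M) exp (2 l t)`.
  have dR : ∀ t, HasDerivAt
      (fun t => Real.exp (l * t) * Y t - S0 / M / (2 * l) * Real.exp ((2 * l) * t))
      (Real.exp (l * t) * (P t + l * Y t - S0 / M * Real.exp (l * t))) t := fun t => by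
    refine (((dexp l t).mul (hY t)).sub
      ((dexp (2 * l) t).const_mul (S0 / M / (2 * l)))).congr_deriv ?_
    have : Real.exp (2 * l * t) = Real.exp (l * t) * Real.exp (l * t) := by
      rw [← Real.exp_add]; ring_nf
    rw [this]
    field_simp
    ring
  have monoR : MonotoneOn
      (fun t => Real.exp (l * t) * Y t - S0 / M / (2 * l) * Real.exp ((2 * l) * t)) (Icc 0 T) := by
    apply monotoneOn_of_deriv_nonneg (convex_Icc _ _)
      (fun s _ => (dR s).continuousAt.continuousWithinAt)
      (fun s _ => (dR s).differentiableAt.differentiableWithinAt)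
    intro s hs
    rw [(dR s).deriv]
    exact mul_nonneg (Real.exp_pos _).le (by linarith [hsum s (interior_subset hs)])
  have hYlow : ∀ s ∈ Icc 1 T, S0 / (8 * M) * Real.exp (l * s) ≤ Y s := by
    intro s hs
    have hs' : s ∈ Icc 0 T := ⟨by linarith [hs.1], hs.2⟩
    have h1 := monoR ⟨le_rfl, hs'.1.trans hs'.2⟩ hs' hs'.1
    simp only [mul_zero, Real.exp_zero, one_mul, mul_one] at h1
    set x := Real.exp (l * s) with hx
    have hxx : Real.exp (2 * l * s) = x * x := by
      rw [hx, ← Real.exp_add]; ring_nf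
    -- For `s ≥ 1` one has `x ≥ 2`, so that `x² - 1 ≥ x²/2` absorbs the contribution from time zero.
    have hx2 : 2 ≤ x := by
      have h3 := Real.add_one_le_exp (l * s)
      have h4 : 1 ≤ l * s := by nlinarith [hs.1]
      linarith
    rw [hxx] at h1
    have hk : S0 / M / (2 * l) ≥ S0 / M / 4 := by
      apply div_le_div_of_nonneg_left (by positivity) (by positivity) (by linarith)
    have h2 : S0 / M / (2 * l) * (x * x - 1) ≤ x * Y s := by linarith
    have h3 : S0 / M / 4 * (x * x - 1) ≤ x * Y s :=
      (mul_le_mul_of_nonneg_right hk (by nlinarith)).trans h2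
    have h4 : S0 / M / 4 * (x * x / 2) ≤ x * Y s :=
      (mul_le_mul_of_nonneg_left (by nlinarith) (by positivity)).trans h3
    have h5 : x * (S0 / (8 * M) * x) ≤ x * Y s := by
      calc _ = S0 / M / 4 * (x * x / 2) := by field_simp; ring
        _ ≤ _ := h4
    exact le_of_mul_le_mul_left h5 (by positivity)
  have he2 : Real.exp (-2) ≤ 1 := Real.exp_le_one_iff.2 (by norm_num)
  have ht' : t ∈ Icc 0 T := ⟨by linarith, htT⟩
  constructor
  · have h1 := h t ht'
    -- The velocity is recovered from the last unit of time only; this requires `t - 1 ≥ 1`, and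
    -- costs the factor `exp (-l) ≥ exp (-2)`.
    have h2 : (∫ s in (t - 1)..t, S0 / (8 * M) * Real.exp (l * (t - 1)))
        ≤ ∫ s in (t - 1)..t, factor b s * Y s := by
      apply intervalIntegral.integral_mono_on (by linarith) (by simp)
        ((hm.mul hYc).intervalIntegrable _ _)
      intro s hs
      have hs1 : s ∈ Icc 1 T := ⟨by linarith [hs.1], hs.2.trans htT⟩
      have h3 := hYlow s hs1
      have h4 : Real.exp (l * (t - 1)) ≤ Real.exp (l * s) :=
        Real.exp_le_exp.2 (mul_le_mul_of_nonneg_left hs.1 hl0.le)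
      have h5 := one_le_factor hb hb0 (t := s) (by linarith [hs1.1])
      have h6 : S0 / (8 * M) * Real.exp (l * (t - 1)) ≤ Y s :=
        (mul_le_mul_of_nonneg_left h4 (by positivity)).trans h3
      have h7 : 0 ≤ Y s := le_trans (by positivity) h6
      exact h6.trans (le_mul_of_one_le_left h7 h5)
    have h3 : (∫ s in (t - 1)..t, factor b s * Y s) ≤ ∫ s in (0 : ℝ)..t, factor b s * Y s := by
      apply intervalIntegral.integral_mono_interval (by linarith) (by linarith) le_rfl
      · rw [Filter.EventuallyLE, ae_restrict_iff' measurableSet_Ioc]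
        refine Filter.Eventually.of_forall fun s hs => ?_
        exact mul_nonneg (factor_pos b s).le (hYn s ⟨hs.1.le, hs.2.trans htT⟩)
      · exact (hm.mul hYc).intervalIntegrable _ _
    rw [intervalIntegral.integral_const, smul_eq_mul] at h2
    have h4 : S0 / (8 * M) * (Real.exp (-2) * Real.exp (l * t)) ≤ factor b t * P t := by
      have h5 : Real.exp (-2) * Real.exp (l * t) ≤ Real.exp (l * (t - 1)) := by
        rw [← Real.exp_add]
        exact Real.exp_le_exp.2 (by nlinarith)
      have h6 := mul_le_mul_of_nonneg_left h5 (show 0 ≤ S0 / (8 * M) by positivity)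
      have h7 : 0 ≤ ∫ s in (0 : ℝ)..t, factor b s * Y s :=
        intervalIntegral.integral_nonneg ht'.1
          fun s hs => mul_nonneg (factor_pos b s).le (hYn s ⟨hs.1, hs.2.trans htT⟩)
      have h8 : (1 : ℝ) ≤ l ^ 2 := one_le_pow₀ hl1
      have h9 := le_mul_of_one_le_left h7 h8
      have h10 : (t - (t - 1)) * (S0 / (8 * M) * Real.exp (l * (t - 1)))
        = S0 / (8 * M) * Real.exp (l * (t - 1)) := by ring
      linarith
    have h5 : 0 ≤ P t := by
      by_contra hc
      push Not at hc
      have : 0 ≤ S0 / (8 * M) * (Real.exp (-2) * Real.exp (l * t)) := by positivity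
      nlinarith [factor_pos b t]
    have h6 := h4.trans (mul_le_mul_of_nonneg_right (hM t) h5)
    have h7 : M * (Real.exp (-2) / (8 * M ^ 2) * S0 * Real.exp (l * t)) ≤ M * P t := by
      calc _ = S0 / (8 * M) * (Real.exp (-2) * Real.exp (l * t)) := by field_simp
        _ ≤ _ := h6
    exact le_of_mul_le_mul_left h7 hM0
  · refine le_trans ?_ (hYlow t ⟨by linarith, htT⟩)
    apply mul_le_mul_of_nonneg_right _ (Real.exp_pos _).le
    rw [div_mul_eq_mul_div, div_le_div_iff₀ (by positivity) (by positivity)]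
    have h1 : Real.exp (-2) * S0 ≤ S0 := by nlinarith
    have h2 : M ≤ M ^ 2 := by nlinarith
    calc Real.exp (-2) * S0 * (8 * M) ≤ S0 * (8 * M) := by gcongr
      _ ≤ S0 * (8 * M ^ 2) := by gcongr

/-! ### Blow-up of the system of integral inequalities -/

/-- A function on `[T/2, T]` whose lower bounds improve superlinearly on shrinking subintervals
cannot be too large. -/
theorem slice_bound {A : ℝ → ℝ} {T r σ K α₀ : ℝ} (hT : 0 < T) (hr : 1 < r) (hσ : 0 < σ)
    (hα₀ : 0 < α₀)
    (h : ∀ a δ α, T / 2 ≤ a → 0 < δ → a + 3 * δ ≤ T → 0 < α → (∀ t ∈ Icc a T, α ≤ A t) →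
      ∀ t ∈ Icc (a + 3 * δ) T, K * α ^ r * (δ / T) ^ σ ≤ A t)
    (h0 : ∀ t ∈ Icc (T / 2) T, α₀ ≤ A t) :
    K * α₀ ^ (r - 1) < 12 ^ σ * 2 ^ (σ / (r - 1)) := by
  by_contra hc
  push Not at hc
  have hr' : 0 < r - 1 := by linarith
  -- Chosen so that the gain `B^(j(r-1))` of the `j`-th step exactly cancels the loss `2^(-jσ)` from
  -- the shrinking slice width.
  set B : ℝ := 2 ^ (σ / (r - 1)) with hB
  have hB1 : 1 < B := Real.one_lt_rpow (by norm_num) (by positivity)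
  have hB0 : 0 < B := by linarith
  have hBr : B ^ (r - 1) = 2 ^ σ := by
    rw [hB, ← Real.rpow_mul (by norm_num), div_mul_cancel₀ _ hr'.ne']
  have claim : ∀ j : ℕ, ∀ t ∈ Icc (T - T / 2 * (1 / 2) ^ j) T, α₀ * B ^ j ≤ A t := by
    intro j
    induction j with
    | zero =>
      intro t ht
      have := h0 t ⟨by have := ht.1; simp only [pow_zero] at this; linarith, ht.2⟩
      simpa using this
    | succ j ih =>
      intro t ht
      have hp1 : (1 / 2 : ℝ) ^ j ≤ 1 := pow_le_one₀ (by norm_num) (by norm_num)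
      have hp0 : (0 : ℝ) < (1 / 2) ^ j := by positivity
      -- Three widths `T 2^(-j)/12` make up the gap `T 2^(-j)/4` between consecutive left endpoints.
      have hs := h (T - T / 2 * (1 / 2) ^ j) (T * (1 / 2) ^ j / 12) (α₀ * B ^ j)
        (by nlinarith) (by positivity) (by nlinarith) (by positivity) ih t
        ⟨by have := ht.1; rw [pow_succ] at this; linarith, ht.2⟩
      refine le_trans ?_ hs
      have e1 : T * (1 / 2 : ℝ) ^ j / 12 / T = (1 / 2) ^ j / 12 := by field_simp
      have e2 : (α₀ * B ^ j) ^ r = α₀ ^ (r - 1) * (2 ^ σ) ^ j * (α₀ * B ^ j) := by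
        have : r = (r - 1) + 1 := by ring
        conv_lhs => rw [this]
        rw [Real.rpow_add_one (by positivity), Real.mul_rpow hα₀.le (by positivity),
          ← Real.rpow_natCast B j, ← Real.rpow_mul hB0.le, mul_comm (j : ℝ), Real.rpow_mul hB0.le,
          hBr, Real.rpow_natCast]
      have e3 : ((1 / 2 : ℝ) ^ j / 12) ^ σ = ((2 ^ σ) ^ j)⁻¹ / 12 ^ σ := by
        rw [Real.div_rpow (by positivity) (by norm_num), ← Real.rpow_natCast (1 / 2 : ℝ) j,
          ← Real.rpow_mul (by norm_num), mul_comm (j : ℝ), Real.rpow_mul (by norm_num),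
          Real.rpow_natCast, Real.div_rpow (by norm_num) (by norm_num), Real.one_rpow, one_div,
          inv_pow]
      rw [e1, e2, e3, pow_succ]
      have h12 : (0 : ℝ) < 12 ^ σ := by positivity
      have h2 : (0 : ℝ) < (2 ^ σ) ^ j := by positivity
      have hx : 0 < α₀ * B ^ j := by positivity
      calc α₀ * (B ^ j * B) = (12 ^ σ * B) * (α₀ * B ^ j) / 12 ^ σ := by field_simp
        _ ≤ (K * α₀ ^ (r - 1)) * (α₀ * B ^ j) / 12 ^ σ := by gcongr
        _ = _ := by field_simp
  -- The endpoint `T` belongs to every slice, so `A T` would exceed all terms of a divergent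
  -- geometric sequence.
  obtain ⟨j, hj⟩ := pow_unbounded_of_one_lt (A T / α₀) hB1
  have := claim j T ⟨by have : (0 : ℝ) < (1 / 2) ^ j := by positivity
                        nlinarith, le_rfl⟩
  rw [div_lt_iff₀ hα₀] at hj
  linarith

theorem le_integral_of_le {N : ℝ → ℝ} {T κ a δ t : ℝ} (hN : IntervalIntegrable N volume 0 T)
    (hN0 : ∀ s ∈ Icc 0 T, 0 ≤ N s) (ha : 0 ≤ a) (hδ : 0 < δ) (hκ : 0 ≤ κ)
    (h : ∀ᵐ s, s ∈ Icc a T → κ ≤ N s) (ht : t ∈ Icc (a + δ) T) :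
    κ * δ ≤ ∫ s in (0 : ℝ)..t, N s := by
  have hat : a ≤ t := by linarith [ht.1]
  have h0t : 0 ≤ t := ha.trans hat
  have hsub : ∀ x ∈ Icc 0 t, IntervalIntegrable N volume x t := fun x hx =>
    hN.mono_set (by rw [uIcc_of_le hx.2, uIcc_of_le (h0t.trans ht.2)]
                    exact Icc_subset_Icc hx.1 ht.2)
  have h1 : (∫ s in a..t, κ) ≤ ∫ s in a..t, N s := by
    apply intervalIntegral.integral_mono_ae_restrict hat (by simp) (hsub a ⟨ha, hat⟩)
    rw [Filter.EventuallyLE, ae_restrict_iff' measurableSet_Icc]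
    filter_upwards [h] with s hs hs'
    exact hs ⟨hs'.1, hs'.2.trans ht.2⟩
  have h2 : (∫ s in a..t, N s) ≤ ∫ s in (0 : ℝ)..t, N s := by
    apply intervalIntegral.integral_mono_interval ha hat le_rfl _ (hsub 0 ⟨le_rfl, h0t⟩)
    rw [Filter.EventuallyLE, ae_restrict_iff' measurableSet_Ioc]
    exact Filter.Eventually.of_forall fun s hs => hN0 s ⟨hs.1.le, hs.2.trans ht.2⟩
  rw [intervalIntegral.integral_const, smul_eq_mul] at h1
  nlinarith [ht.1]

theorem le_of_rpow_lt {C ε T B g Θ : ℝ} (hC : 0 < C) (hε : 0 < ε) (hT : 0 < T) (hB : 0 < B)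
    (hg : 0 < g) (hΘ : 0 < Θ) (h : C * (ε ^ g * T ^ (g * Θ)) < B) :
    T ≤ (B / C) ^ (1 / (g * Θ)) * ε ^ (-Θ⁻¹) := by
  have hεg : 0 < ε ^ g := Real.rpow_pos_of_pos hε g
  have h1 : T ^ (g * Θ) ≤ B / C * ε ^ (-g) := by
    rw [Real.rpow_neg hε.le, ← div_eq_mul_inv, div_div, le_div_iff₀ (by positivity)]
    linarith
  have h2 := Real.rpow_le_rpow (by positivity) h1 (show 0 ≤ 1 / (g * Θ) by positivity)
  rw [← Real.rpow_mul hT.le, mul_one_div_cancel (by positivity), Real.rpow_one,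
    Real.mul_rpow (by positivity) (by positivity), ← Real.rpow_mul hε.le] at h2
  have e : -g * (1 / (g * Θ)) = -Θ⁻¹ := by field_simp
  rwa [e] at h2

/-- The integral inequalities satisfied by `A = ∫ ∂ₜu`, `V = ∫ v` and the nonlinear terms
`Np = ∫ |∂ₜu|^p`, `Nq = ∫ |v|^q` on a time interval `[0, T]`. -/
structure AveragedSystem (ν p q c ε T : ℝ) (A V W Np Nq : ℝ → ℝ) : Prop where
  A_ge : ∀ t ∈ Icc 0 T, c * (∫ s in (0 : ℝ)..t, Nq s) ≤ A t
  W_ge : ∀ t ∈ Icc 0 T, c * (∫ s in (0 : ℝ)..t, Np s) ≤ W t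
  V_ge : ∀ t ∈ Icc 0 T, (∫ s in (0 : ℝ)..t, W s) ≤ V t
  W_cont : Continuous W
  Np_int : IntervalIntegrable Np volume 0 T
  Nq_int : IntervalIntegrable Nq volume 0 T
  Np_nonneg : ∀ t, 0 ≤ Np t
  Nq_nonneg : ∀ t, 0 ≤ Nq t
  Np_ge : ∀ᵐ s, s ∈ Icc 0 T → c * T ^ (-(ν * (p - 1))) * |A s| ^ p ≤ Np s
  Nq_ge : ∀ᵐ s, s ∈ Icc 0 T → c * T ^ (-(ν * (q - 1))) * |V s| ^ q ≤ Nq s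
  Np_ge' : ∀ᵐ s, s ∈ Icc (T / 4) T → c * ε ^ p * T ^ ((ν - 1) * (1 - p / 2)) ≤ Np s
  Nq_ge' : ∀ᵐ s, s ∈ Icc (T / 4) T → c * ε ^ q * T ^ ((ν - 1) * (1 - q / 2)) ≤ Nq s

/-! ### Iteration of the averaged inequalities and the two lifespan bounds. -/

namespace AveragedSystem

variable {ν p q c ε T : ℝ} {A V W Np Nq : ℝ → ℝ}

theorem A_lower (S : AveragedSystem ν p q c ε T A V W Np Nq) (hc : 0 < c) {κ a δ : ℝ}
    (ha : 0 ≤ a) (hδ : 0 < δ) (hκ : 0 ≤ κ) (h : ∀ᵐ s, s ∈ Icc a T → κ ≤ Nq s) {t : ℝ}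
    (ht : t ∈ Icc (a + δ) T) : c * (κ * δ) ≤ A t :=
  (mul_le_mul_of_nonneg_left
    (le_integral_of_le S.Nq_int (fun s _ => S.Nq_nonneg s) ha hδ hκ h ht) hc.le).trans
    (S.A_ge t ⟨by linarith [ht.1], ht.2⟩)

theorem V_lower (S : AveragedSystem ν p q c ε T A V W Np Nq) (hc : 0 < c) {κ a δ : ℝ}
    (ha : 0 ≤ a) (hδ : 0 < δ) (hκ : 0 ≤ κ) (h : ∀ᵐ s, s ∈ Icc a T → κ ≤ Np s) {t : ℝ}
    (ht : t ∈ Icc (a + 2 * δ) T) : c * (κ * δ ^ 2) ≤ V t := by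
  have h1 : ∀ s ∈ Icc (a + δ) T, c * (κ * δ) ≤ W s := fun s hs =>
    (mul_le_mul_of_nonneg_left
      (le_integral_of_le S.Np_int (fun s _ => S.Np_nonneg s) ha hδ hκ h hs) hc.le).trans
      (S.W_ge s ⟨by linarith [hs.1], hs.2⟩)
  have hW0 : ∀ s ∈ Icc 0 T, 0 ≤ W s := fun s hs =>
    (mul_nonneg hc.le (intervalIntegral.integral_nonneg hs.1 fun s _ => S.Np_nonneg s)).trans
      (S.W_ge s hs)
  have h2 := le_integral_of_le (T := T) (κ := c * (κ * δ)) (a := a + δ) (δ := δ) (t := t)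
    (S.W_cont.intervalIntegrable _ _) hW0 (by linarith) hδ (by positivity)
    (Filter.Eventually.of_forall h1) ⟨by linarith [ht.1], ht.2⟩
  calc c * (κ * δ ^ 2) = c * (κ * δ) * δ := by ring
    _ ≤ _ := h2
    _ ≤ _ := S.V_ge t ⟨by linarith [ht.1], ht.2⟩

theorem A_lower_of_V (S : AveragedSystem ν p q c ε T A V W Np Nq) (hq : 1 < q) (hc : 0 < c)
    (hT : 0 < T) {β a δ : ℝ} (ha : 0 ≤ a) (hδ : 0 < δ) (hβ : 0 ≤ β)
    (h : ∀ s ∈ Icc a T, β ≤ V s) {t : ℝ} (ht : t ∈ Icc (a + δ) T) :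
    c * (c * T ^ (-(ν * (q - 1))) * β ^ q * δ) ≤ A t := by
  apply S.A_lower hc ha hδ (by positivity) _ ht
  filter_upwards [S.Nq_ge] with s hs hsa
  refine le_trans ?_ (hs ⟨ha.trans hsa.1, hsa.2⟩)
  have h1 : β ≤ |V s| := (h s hsa).trans (le_abs_self _)
  gcongr

theorem V_lower_of_A (S : AveragedSystem ν p q c ε T A V W Np Nq) (hp : 1 < p) (hc : 0 < c)
    (hT : 0 < T) {α a δ : ℝ} (ha : 0 ≤ a) (hδ : 0 < δ) (hα : 0 ≤ α)
    (h : ∀ s ∈ Icc a T, α ≤ A s) {t : ℝ} (ht : t ∈ Icc (a + 2 * δ) T) :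
    c * (c * T ^ (-(ν * (p - 1))) * α ^ p * δ ^ 2) ≤ V t := by
  apply S.V_lower hc ha hδ (by positivity) _ ht
  filter_upwards [S.Np_ge] with s hs hsa
  refine le_trans ?_ (hs ⟨ha.trans hsa.1, hsa.2⟩)
  have h1 : α ≤ |A s| := (h s hsa).trans (le_abs_self _)
  gcongr

/-- One round trip from `A` to `V` (two time integrations, `2δ`) and back to `A` (one integration,
`δ`) is the hypothesis of `slice_bound` with `r = pq` and `σ = 2q + 1`. -/
theorem bound_of_initial (S : AveragedSystem ν p q c ε T A V W Np Nq) (hp : 1 < p) (hq : 1 < q)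
    (hc : 0 < c) (hT : 0 < T) {α₀ : ℝ} (hα₀ : 0 < α₀) (h0 : ∀ t ∈ Icc (T / 2) T, α₀ ≤ A t) :
    c ^ (2 + 2 * q) * T ^ (2 * q + 1 - ν * (p * q - 1)) * α₀ ^ (p * q - 1)
      < 12 ^ (2 * q + 1) * 2 ^ ((2 * q + 1) / (p * q - 1)) := by
  apply slice_bound hT (by nlinarith) (by linarith) hα₀ _ h0
  intro a δ α ha hδ haδ hα hA t ht
  have hV := fun s hs => S.V_lower_of_A (t := s) hp hc hT (by linarith) hδ hα.le hA hs
  have h1 := S.A_lower_of_V (t := t) hq hc hT (by linarith) hδ (by positivity) hV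
    ⟨by linarith [ht.1], ht.2⟩
  refine le_of_eq_of_le ?_ h1
  -- Both sides are monomials in positive quantities; after taking logarithms, matching exponents is
  -- linear algebra.
  apply Real.log_injOn_pos (by simp only [mem_Ioi]; positivity) (by simp only [mem_Ioi]; positivity)
  have lm : ∀ x y : ℝ, 0 < x → 0 < y → Real.log (x * y) = Real.log x + Real.log y :=
    fun x y hx hy => Real.log_mul hx.ne' hy.ne'
  rw [lm _ _ (by positivity) (by positivity), lm _ _ (by positivity) (by positivity),
    lm _ _ (by positivity) (by positivity), lm _ _ (by positivity) (by positivity),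
    lm _ _ (by positivity) (by positivity), lm _ _ (by positivity) (by positivity),
    lm _ _ (by positivity) (by positivity), Real.log_rpow hc, Real.log_rpow hT,
    Real.log_rpow hα, Real.log_rpow (by positivity), Real.log_div hδ.ne' hT.ne',
    Real.log_rpow hT, Real.log_rpow (by positivity), lm _ _ (by positivity) (by positivity),
    lm _ _ (by positivity) (by positivity), lm _ _ (by positivity) (by positivity),
    lm _ _ (by positivity) (by positivity), Real.log_rpow hT, Real.log_rpow hα, Real.log_pow]
  push_cast
  ring

/-- The starting value for `A` comes directly from `Nq_ge'`, integrated over a time `T/4`. It is of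
order `ε^q`, whence `g = q(pq-1)`. -/
theorem lifespan_two (ν : ℝ) {p q c : ℝ} (hp : 1 < p) (hq : 1 < q) (hc : 0 < c)
    (hΘ : 0 < (2 + q⁻¹) / (p * q - 1) - (ν - 1) / 2) :
    ∃ C : ℝ, 0 < C ∧ ∀ (ε T : ℝ) (A V W Np Nq : ℝ → ℝ), 0 < ε → 0 < T →
      AveragedSystem ν p q c ε T A V W Np Nq →
      T ≤ C * ε ^ (-((2 + q⁻¹) / (p * q - 1) - (ν - 1) / 2)⁻¹) := by
  have hr : 0 < p * q - 1 := by nlinarith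
  set B : ℝ := 12 ^ (2 * q + 1) * 2 ^ ((2 * q + 1) / (p * q - 1)) with hB
  set C₁ : ℝ := c ^ (2 + 2 * q) * (c ^ 2 / 4) ^ (p * q - 1) with hC₁
  set Θ := (2 + q⁻¹) / (p * q - 1) - (ν - 1) / 2 with hΘdef
  set g := q * (p * q - 1) with hg
  refine ⟨(B / C₁) ^ (1 / (g * Θ)), by positivity, ?_⟩
  intro ε T A V W Np Nq hε hT S
  apply le_of_rpow_lt (by positivity) hε hT (by positivity) (by positivity) hΘ
  have h1 := S.bound_of_initial hp hq hc hT
    (α₀ := c * (c * ε ^ q * T ^ ((ν - 1) * (1 - q / 2)) * (T / 4))) (by positivity)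
    (fun t ht => S.A_lower hc (by positivity) (by positivity) (by positivity) S.Nq_ge'
      ⟨by linarith [ht.1], ht.2⟩)
  refine lt_of_eq_of_lt ?_ h1
  apply Real.log_injOn_pos (by simp only [mem_Ioi]; positivity) (by simp only [mem_Ioi]; positivity)
  have lm : ∀ x y : ℝ, 0 < x → 0 < y → Real.log (x * y) = Real.log x + Real.log y :=
    fun x y hx hy => Real.log_mul hx.ne' hy.ne'
  have e : g * Θ = 2 * q + 1 - (p * q - 1) * q * (ν - 1) / 2 := by
    have hr' : q * p - 1 ≠ 0 := by nlinarith
    rw [hg, hΘdef]; field_simp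
  rw [e, hC₁, lm _ _ (by positivity) (by positivity), lm _ _ (by positivity) (by positivity),
    lm _ _ (by positivity) (by positivity), lm _ _ (by positivity) (by positivity),
    lm _ _ (by positivity) (by positivity), Real.log_rpow hc, Real.log_rpow (by positivity),
    Real.log_rpow hε, Real.log_rpow hT, Real.log_rpow hT, Real.log_rpow (by positivity),
    lm _ _ (by positivity) (by positivity), lm _ _ (by positivity) (by positivity),
    lm _ _ (by positivity) (by positivity), lm _ _ (by positivity) (by positivity),
    Real.log_rpow hε, Real.log_rpow hT, Real.log_div hT.ne' (by norm_num),
    Real.log_div (by positivity) (by norm_num), Real.log_pow, hg]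
  push_cast
  ring

/-- The starting value for `A` comes from `Np_ge'` by way of `V`. It is of order `ε^(pq)`, whence `g
= pq(pq-1)`. The waiting times `2·T/16` and `T/8` bring `T/4` to `T/2`. -/
theorem lifespan_one (ν : ℝ) {p q c : ℝ} (hp : 1 < p) (hq : 1 < q) (hc : 0 < c)
    (hΘ : 0 < (q + 1 + p⁻¹) / (p * q - 1) - (ν - 1) / 2) :
    ∃ C : ℝ, 0 < C ∧ ∀ (ε T : ℝ) (A V W Np Nq : ℝ → ℝ), 0 < ε → 0 < T →
      AveragedSystem ν p q c ε T A V W Np Nq →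
      T ≤ C * ε ^ (-((q + 1 + p⁻¹) / (p * q - 1) - (ν - 1) / 2)⁻¹) := by
  have hr : 0 < p * q - 1 := by nlinarith
  set B : ℝ := 12 ^ (2 * q + 1) * 2 ^ ((2 * q + 1) / (p * q - 1)) with hB
  set C₁ : ℝ := c ^ (2 + 2 * q) * (c ^ 2 / 8 * (c ^ 2 / 256) ^ q) ^ (p * q - 1) with hC₁
  set Θ := (q + 1 + p⁻¹) / (p * q - 1) - (ν - 1) / 2 with hΘdef
  set g := p * q * (p * q - 1) with hg
  refine ⟨(B / C₁) ^ (1 / (g * Θ)), by positivity, ?_⟩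
  intro ε T A V W Np Nq hε hT S
  apply le_of_rpow_lt (by positivity) hε hT (by positivity) (by positivity) hΘ
  have hV : ∀ t ∈ Icc (3 * T / 8) T,
      c * (c * ε ^ p * T ^ ((ν - 1) * (1 - p / 2)) * (T / 16) ^ 2) ≤ V t := fun t ht =>
    S.V_lower hc (by positivity) (by positivity) (by positivity) S.Np_ge'
      ⟨by linarith [ht.1], ht.2⟩
  have h1 := S.bound_of_initial hp hq hc hT
    (α₀ := c * (c * T ^ (-(ν * (q - 1))) *
      (c * (c * ε ^ p * T ^ ((ν - 1) * (1 - p / 2)) * (T / 16) ^ 2)) ^ q * (T / 8)))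
    (by positivity)
    (fun t ht => S.A_lower_of_V hq hc hT (by positivity) (by positivity) (by positivity) hV
      ⟨by linarith [ht.1], ht.2⟩)
  refine lt_of_eq_of_lt ?_ h1
  apply Real.log_injOn_pos (by simp only [mem_Ioi]; positivity) (by simp only [mem_Ioi]; positivity)
  have lm : ∀ x y : ℝ, 0 < x → 0 < y → Real.log (x * y) = Real.log x + Real.log y :=
    fun x y hx hy => Real.log_mul hx.ne' hy.ne'
  have e : g * Θ = p * q * (q + 1) + q - (p * q - 1) * (p * q) * (ν - 1) / 2 := by
    have hr' : q * p - 1 ≠ 0 := by nlinarith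
    rw [hg, hΘdef]; field_simp
  have l256 : Real.log (c ^ 2 / 256) = 2 * Real.log c - 2 * Real.log 16 := by
    rw [Real.log_div (by positivity) (by norm_num), Real.log_pow,
      show (256 : ℝ) = 16 ^ 2 by norm_num, Real.log_pow]
    push_cast; ring
  rw [e, hC₁, lm _ _ (by positivity) (by positivity), lm _ _ (by positivity) (by positivity),
    lm _ _ (by positivity) (by positivity), lm _ _ (by positivity) (by positivity),
    Real.log_rpow hc, Real.log_rpow (by positivity), lm _ _ (by positivity) (by positivity),
    Real.log_rpow (by positivity), l256, Real.log_rpow hε, Real.log_rpow hT,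
    lm _ _ (by positivity) (by positivity), Real.log_rpow hc, Real.log_rpow hT,
    Real.log_rpow (by positivity), lm _ _ (by positivity) (by positivity),
    lm _ _ (by positivity) (by positivity), lm _ _ (by positivity) (by positivity),
    lm _ _ (by positivity) (by positivity), Real.log_rpow hT, Real.log_rpow (by positivity),
    lm _ _ (by positivity) (by positivity), lm _ _ (by positivity) (by positivity),
    lm _ _ (by positivity) (by positivity), lm _ _ (by positivity) (by positivity),
    Real.log_rpow hε, Real.log_rpow hT, Real.log_pow,
    Real.log_div hT.ne' (by norm_num), Real.log_div hT.ne' (by norm_num),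
    Real.log_div (by positivity) (by norm_num), Real.log_pow, hg]
  push_cast
  ring

end AveragedSystem

/-! ### A positive solution of the wave equation concentrated near the light cone -/

/-- The spherical shell of frequencies `1 ≤ ‖ξ‖ ≤ 2`. -/
def shell (n : ℕ) : Set (EuclideanSpace ℝ (Fin n)) := {ξ | 1 ≤ ‖ξ‖ ∧ ‖ξ‖ ≤ 2}

/-- The superposition of the exponentials `exp (ξ·x - |ξ| τ)` over the shell. -/
noncomputable def waveWeight {n : ℕ} (τ : ℝ) (x : EuclideanSpace ℝ (Fin n)) : ℝ :=
  ∫ ξ in shell n, Real.exp (inner ℝ ξ x - ‖ξ‖ * τ)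

variable {n : ℕ}

theorem isCompact_shell : IsCompact (shell n) := by
  apply (isCompact_closedBall (0 : EuclideanSpace ℝ (Fin n)) 2).of_isClosed_subset
  · exact (isClosed_le continuous_const continuous_norm).inter
      (isClosed_le continuous_norm continuous_const)
  · intro ξ hξ
    simpa using hξ.2

theorem measurableSet_shell : MeasurableSet (shell n) := isCompact_shell.isClosed.measurableSet

theorem continuous_exp_phase (τ : ℝ) :
    Continuous fun z : EuclideanSpace ℝ (Fin n) × EuclideanSpace ℝ (Fin n) =>
      Real.exp (inner ℝ z.1 z.2 - ‖z.1‖ * τ) := by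
  fun_prop

theorem integrableOn_exp_phase (τ : ℝ) (x : EuclideanSpace ℝ (Fin n)) :
    IntegrableOn (fun ξ => Real.exp (inner ℝ ξ x - ‖ξ‖ * τ)) (shell n) :=
  ContinuousOn.integrableOn_compact isCompact_shell (by fun_prop)

theorem waveWeight_nonneg (τ : ℝ) (x : EuclideanSpace ℝ (Fin n)) : 0 ≤ waveWeight τ x :=
  integral_nonneg fun _ => (Real.exp_pos _).le

theorem stronglyMeasurable_waveWeight (τ : ℝ) :
    StronglyMeasurable (waveWeight τ : EuclideanSpace ℝ (Fin n) → ℝ) :=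
  StronglyMeasurable.integral_prod_left
    (f := fun (ξ x : EuclideanSpace ℝ (Fin n)) => Real.exp (inner ℝ ξ x - ‖ξ‖ * τ))
    (continuous_exp_phase τ).stronglyMeasurable

/-- The left side is a Gaussian in the component of `ξ` orthogonal to `e`. Covering the range `[-2,
2]` of the component along `e` by points at spacing `1/√τ` dominates it by about `4√τ` full
Gaussians, which avoids splitting the space into coordinates. -/
theorem exp_transverse_le_sum {V : Type*} [NormedAddCommGroup V] [InnerProductSpace ℝ V]
    {e ξ : V} (he : ‖e‖ = 1) (hξ : ‖ξ‖ ≤ 2) {τ : ℝ} (hτ : 0 < τ) :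
    Real.exp (-(τ / 8 * (‖ξ‖ ^ 2 - inner ℝ ξ e ^ 2))) ≤
      Real.exp (1 / 8) * ∑ k ∈ Finset.range (⌊4 * √τ⌋₊ + 1),
        Real.exp (-(τ / 8) * ‖ξ - (-2 + k / √τ) • e‖ ^ 2) := by
  set s : ℝ := inner ℝ ξ e with hs
  have hsq : 0 < √τ := Real.sqrt_pos.2 hτ
  have hsabs : |s| ≤ 2 := (abs_real_inner_le_norm ξ e).trans (by rw [he, mul_one]; exact hξ)
  obtain ⟨hs1, hs2⟩ := abs_le.1 hsabs
  have hpos : 0 ≤ (s + 2) * √τ := mul_nonneg (by linarith) hsq.le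
  -- Index of the grid point just below `s`; its distance to `s` is at most `1/√τ`, which costs the
  -- factor `exp (1/8)`.
  set k := ⌊(s + 2) * √τ⌋₊ with hk
  have hk1 : (k : ℝ) ≤ (s + 2) * √τ := Nat.floor_le hpos
  have hk2 : (s + 2) * √τ < k + 1 := Nat.lt_floor_add_one _
  have hmem : k ∈ Finset.range (⌊4 * √τ⌋₊ + 1) := by
    rw [Finset.mem_range, Nat.lt_succ_iff]
    exact Nat.floor_le_floor (mul_le_mul_of_nonneg_right (by linarith) hsq.le)
  have hterm : Real.exp (-(τ / 8) * ‖ξ - (-2 + k / √τ) • e‖ ^ 2)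
      ≤ ∑ k ∈ Finset.range (⌊4 * √τ⌋₊ + 1),
        Real.exp (-(τ / 8) * ‖ξ - (-2 + k / √τ) • e‖ ^ 2) :=
    Finset.single_le_sum
      (f := fun k : ℕ => Real.exp (-(τ / 8) * ‖ξ - (-2 + k / √τ) • e‖ ^ 2))
      (fun _ _ => (Real.exp_pos _).le) hmem
  refine le_trans ?_ (mul_le_mul_of_nonneg_left hterm (Real.exp_pos _).le)
  rw [← Real.exp_add]
  apply Real.exp_le_exp.2
  have hnorm : ‖ξ - (-2 + k / √τ) • e‖ ^ 2 = ‖ξ‖ ^ 2 - s ^ 2 + (s - (-2 + k / √τ)) ^ 2 := by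
    rw [norm_sub_sq_real, inner_smul_right, norm_smul, he, ← hs, Real.norm_eq_abs, mul_one, sq_abs]
    ring
  rw [hnorm]
  have hd : τ * (s - (-2 + k / √τ)) ^ 2 ≤ 1 := by
    have e1 : τ * (s - (-2 + k / √τ)) ^ 2 = ((s + 2) * √τ - k) ^ 2 := by
      have h1 : τ = √τ ^ 2 := (Real.sq_sqrt hτ.le).symm
      have h2 : (s + 2) * √τ - k = √τ * (s - (-2 + k / √τ)) := by field_simp; ring
      rw [h2, mul_pow, ← h1]
    rw [e1, sq_le_one_iff₀ (by linarith)]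
    linarith
  nlinarith

theorem exists_unit_vector (hn : 1 ≤ n) (x : EuclideanSpace ℝ (Fin n)) :
    ∃ e : EuclideanSpace ℝ (Fin n), ‖e‖ = 1 ∧ x = ‖x‖ • e := by
  by_cases hx : x = 0
  · refine ⟨EuclideanSpace.single ⟨0, hn⟩ 1, by simp, by simp [hx]⟩
  · have : ‖x‖ ≠ 0 := norm_ne_zero_iff.2 hx
    refine ⟨‖x‖⁻¹ • x, ?_, ?_⟩
    · rw [norm_smul, norm_inv, norm_norm, inv_mul_cancel₀ this]
    · rw [smul_smul, mul_inv_cancel₀ this, one_smul]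

/-- With `l = |ξ|`, `ρ = |x|` and `s = ξ·e`, the phase is `-(l(τ-ρ) + ρ(l-s))`. Here `l ≥ 1`, and `l
+ s ≤ 4` gives `l - s ≥ (l² - s²)/4`. Half of `τ - ρ` is spent on turning `ρ` into `τ` in the
transverse term, using `l² - s² ≤ 4`. -/
theorem exp_phase_le {ξ x e : EuclideanSpace ℝ (Fin n)} (hξ : ξ ∈ shell n) (he : ‖e‖ = 1)
    (hxe : x = ‖x‖ • e) {τ : ℝ} (hx : ‖x‖ ≤ τ) :
    Real.exp (inner ℝ ξ x - ‖ξ‖ * τ) ≤ Real.exp (-((τ - ‖x‖) / 2)) *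
      Real.exp (-(τ / 8 * (‖ξ‖ ^ 2 - inner ℝ ξ e ^ 2))) := by
  obtain ⟨h1, h2⟩ := hξ
  rw [← Real.exp_add]
  apply Real.exp_le_exp.2
  have hin : inner ℝ ξ x = ‖x‖ * inner ℝ ξ e := by
    conv_lhs => rw [hxe]
    rw [inner_smul_right]
  rw [hin]
  set s : ℝ := inner ℝ ξ e with hs
  set ρ := ‖x‖ with hρ
  set l := ‖ξ‖ with hl
  have hρ0 : 0 ≤ ρ := norm_nonneg x
  have hsabs : |s| ≤ l := (abs_real_inner_le_norm ξ e).trans (by rw [he, mul_one])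
  obtain ⟨hs1, hs2⟩ := abs_le.1 hsabs
  have hls : (l ^ 2 - s ^ 2) / 4 ≤ l - s := by nlinarith
  have hls4 : l ^ 2 - s ^ 2 ≤ 4 := by nlinarith
  have hls0 : 0 ≤ l ^ 2 - s ^ 2 := by nlinarith
  nlinarith [mul_nonneg (sub_nonneg.2 hx) (sub_nonneg.2 h1), mul_nonneg hρ0 (sub_nonneg.2 hls),
    mul_nonneg (sub_nonneg.2 hx) (sub_nonneg.2 hls4), mul_nonneg hρ0 hls0]

theorem integrable_gaussian_shift {b : ℝ} (hb : 0 < b) (c : EuclideanSpace ℝ (Fin n)) :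
    Integrable fun ξ => Real.exp (-b * ‖ξ - c‖ ^ 2) := by
  have h := GaussianFourier.integrable_cexp_neg_mul_sq_norm_add (V := EuclideanSpace ℝ (Fin n))
    (b := (b : ℂ)) (by simpa using hb) 0 0
  have h2 : Integrable fun ξ : EuclideanSpace ℝ (Fin n) => Real.exp (-b * ‖ξ‖ ^ 2) := by
    refine h.norm.congr (Filter.Eventually.of_forall fun ξ => ?_)
    simp only [Complex.norm_exp]
    norm_cast
    simp
  exact h2.comp_sub_right c

/-- About `√τ` Gaussians, each of integral `(8π/τ)^(n/2)`, give the decay `τ^(-(n-1)/2)`. -/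
theorem waveWeight_le (hn : 1 ≤ n) {τ : ℝ} (hτ : 1 ≤ τ) {x : EuclideanSpace ℝ (Fin n)}
    (hx : ‖x‖ ≤ τ) :
    waveWeight τ x ≤ Real.exp (1 / 8) * 5 * (8 * Real.pi) ^ ((n : ℝ) / 2) *
      τ ^ (-(((n : ℝ) - 1) / 2)) * Real.exp (-((τ - ‖x‖) / 2)) := by
  have hτ0 : 0 < τ := by linarith
  obtain ⟨e, he, hxe⟩ := exists_unit_vector hn x
  set K := ⌊4 * √τ⌋₊ + 1 with hK
  set g : EuclideanSpace ℝ (Fin n) → ℝ := fun ξ => Real.exp (-((τ - ‖x‖) / 2)) *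
    (Real.exp (1 / 8) * ∑ k ∈ Finset.range K,
      Real.exp (-(τ / 8) * ‖ξ - (-2 + k / √τ) • e‖ ^ 2)) with hg
  have hgi : Integrable g := by
    apply Integrable.const_mul
    apply Integrable.const_mul
    exact integrable_finsetSum _ fun k _ => integrable_gaussian_shift (by positivity) _
  have h1 : waveWeight τ x ≤ ∫ ξ in shell n, g ξ := by
    apply setIntegral_mono_on (integrableOn_exp_phase τ x) hgi.integrableOn measurableSet_shell
    intro ξ hξ
    refine (exp_phase_le hξ he hxe hx).trans ?_
    exact mul_le_mul_of_nonneg_left (exp_transverse_le_sum he hξ.2 hτ0) (Real.exp_pos _).le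
  have h2 : (∫ ξ in shell n, g ξ) ≤ ∫ ξ, g ξ :=
    setIntegral_le_integral hgi (Filter.Eventually.of_forall fun ξ =>
      mul_nonneg (Real.exp_pos _).le (mul_nonneg (Real.exp_pos _).le
        (Finset.sum_nonneg fun _ _ => (Real.exp_pos _).le)))
  have h3 : (∫ ξ, g ξ) = Real.exp (-((τ - ‖x‖) / 2)) * (Real.exp (1 / 8) *
      (K * (Real.pi / (τ / 8)) ^ ((n : ℝ) / 2))) := by
    rw [hg, integral_const_mul, integral_const_mul,
      integral_finsetSum _ fun k _ => integrable_gaussian_shift (by positivity) _]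
    have : ∀ k : ℕ, (∫ ξ : EuclideanSpace ℝ (Fin n),
        Real.exp (-(τ / 8) * ‖ξ - (-2 + k / √τ) • e‖ ^ 2)) = (Real.pi / (τ / 8)) ^ ((n : ℝ) / 2) := by
      intro k
      rw [integral_sub_right_eq_self (fun ξ : EuclideanSpace ℝ (Fin n) =>
        Real.exp (-(τ / 8) * ‖ξ‖ ^ 2)), GaussianFourier.integral_rexp_neg_mul_sq_norm (by positivity)]
      simp
    rw [Finset.sum_congr rfl fun k _ => this k, Finset.sum_const, Finset.card_range, nsmul_eq_mul]
  have hKle : (K : ℝ) ≤ 5 * τ ^ (1 / 2 : ℝ) := by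
    have h4 : (1 : ℝ) ≤ √τ := Real.one_le_sqrt.2 hτ
    have h5 : ((⌊4 * √τ⌋₊ : ℕ) : ℝ) ≤ 4 * √τ := Nat.floor_le (by positivity)
    rw [← Real.sqrt_eq_rpow, hK]
    push_cast
    linarith
  have hpow : (Real.pi / (τ / 8)) ^ ((n : ℝ) / 2)
      = (8 * Real.pi) ^ ((n : ℝ) / 2) * τ ^ (-((n : ℝ) / 2)) := by
    rw [Real.rpow_neg hτ0.le, ← div_eq_mul_inv, ← Real.div_rpow (by positivity) hτ0.le]
    congr 1
    field_simp
  have hsplit : τ ^ (-(((n : ℝ) - 1) / 2)) = τ ^ (1 / 2 : ℝ) * τ ^ (-((n : ℝ) / 2)) := by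
    rw [← Real.rpow_add hτ0]; congr 1; ring
  calc waveWeight τ x ≤ _ := h1.trans (h2.trans h3.le)
    _ ≤ Real.exp (-((τ - ‖x‖) / 2)) * (Real.exp (1 / 8) *
      ((5 * τ ^ (1 / 2 : ℝ)) * (Real.pi / (τ / 8)) ^ ((n : ℝ) / 2))) := by gcongr
    _ = _ := by rw [hpow, hsplit]; ring

/-! ### Integrals of the wave weight over balls. -/

theorem integral_exp_radial_le (hn : 1 ≤ n) {r τ : ℝ} (hr : 0 < r) (hτ : 0 < τ) :
    (∫ x in Metric.closedBall (0 : EuclideanSpace ℝ (Fin n)) τ, Real.exp (-(r * (τ - ‖x‖)))) ≤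
      n * volume.real (Metric.ball (0 : EuclideanSpace ℝ (Fin n)) 1) / r * τ ^ ((n : ℝ) - 1) := by
  have : Nonempty (Fin n) := ⟨⟨0, hn⟩⟩
  have : Nontrivial (EuclideanSpace ℝ (Fin n)) := inferInstance
  set f : ℝ → ℝ := (Iic τ).indicator fun y => Real.exp (-(r * (τ - y))) with hf
  have h1 : (∫ x in Metric.closedBall (0 : EuclideanSpace ℝ (Fin n)) τ,
      Real.exp (-(r * (τ - ‖x‖)))) = ∫ x : EuclideanSpace ℝ (Fin n), f ‖x‖ := by
    rw [← integral_indicator Metric.isClosed_closedBall.measurableSet]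
    congr 1 with x
    simp [hf, indicator]
  rw [h1, integral_fun_norm_addHaar volume f]
  have h2 : (∫ y in Ioi (0 : ℝ), y ^ (n - 1) • f y) ≤ τ ^ ((n : ℝ) - 1) / r := by
    have e1 : (∫ y in Ioi (0 : ℝ), y ^ (n - 1) • f y)
        = ∫ y in (0 : ℝ)..τ, y ^ (n - 1) * Real.exp (-(r * (τ - y))) := by
      rw [intervalIntegral.integral_of_le hτ.le, ← Ioi_inter_Iic, inter_comm,
        ← Measure.restrict_restrict measurableSet_Iic, ← integral_indicator measurableSet_Iic]
      congr 1 with y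
      by_cases hy : y ∈ Iic τ <;> simp [hf, hy]
    have e2 : (∫ y in (0 : ℝ)..τ, y ^ (n - 1) * Real.exp (-(r * (τ - y))))
        ≤ ∫ y in (0 : ℝ)..τ, τ ^ (n - 1) * Real.exp (-(r * (τ - y))) := by
      apply intervalIntegral.integral_mono_on hτ.le
        (Continuous.intervalIntegrable (by fun_prop) _ _)
        (Continuous.intervalIntegrable (by fun_prop) _ _)
      intro y hy
      have := pow_le_pow_left₀ hy.1 hy.2 (n - 1)
      gcongr
    have e3 : (∫ y in (0 : ℝ)..τ, Real.exp (-(r * (τ - y)))) ≤ 1 / r := by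
      have d : ∀ y, HasDerivAt (fun y => Real.exp (-(r * (τ - y))) / r)
          (Real.exp (-(r * (τ - y)))) y := fun y => by
        refine ((((hasDerivAt_id y).const_sub τ).const_mul r).neg.exp.div_const r).congr_deriv ?_
        simp only [id_eq, Pi.neg_apply]
        field_simp
      rw [intervalIntegral.integral_eq_sub_of_hasDerivAt (fun y _ => d y)
        (Continuous.intervalIntegrable (by fun_prop) _ _)]
      simp only [sub_self, mul_zero, neg_zero, Real.exp_zero]
      linarith [show 0 ≤ Real.exp (-(r * (τ - 0))) / r by positivity]
    rw [intervalIntegral.integral_const_mul] at e2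
    have e4 : τ ^ (n - 1) = τ ^ ((n : ℝ) - 1) := by
      rw [← Real.rpow_natCast, Nat.cast_sub hn, Nat.cast_one]
    rw [e1, ← e4]
    refine e2.trans ?_
    rw [div_eq_mul_one_div (τ ^ (n - 1))]
    gcongr
  rw [finrank_euclideanSpace_fin, nsmul_eq_mul, smul_eq_mul]
  calc _ ≤ n * (volume.real (Metric.ball (0 : EuclideanSpace ℝ (Fin n)) 1) *
        (τ ^ ((n : ℝ) - 1) / r)) := by gcongr
    _ = _ := by ring

theorem memLp_waveWeight (hn : 1 ≤ n) (r : ℝ≥0∞) {τ : ℝ} (hτ : 1 ≤ τ) :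
    MemLp (waveWeight τ) r
      (volume.restrict (Metric.closedBall (0 : EuclideanSpace ℝ (Fin n)) τ)) := by
  have : IsFiniteMeasure
      (volume.restrict (Metric.closedBall (0 : EuclideanSpace ℝ (Fin n)) τ)) :=
    ⟨by simpa using measure_closedBall_lt_top⟩
  refine MemLp.of_bound (stronglyMeasurable_waveWeight τ).aestronglyMeasurable
    (Real.exp (1 / 8) * 5 * (8 * Real.pi) ^ ((n : ℝ) / 2) * τ ^ (-(((n : ℝ) - 1) / 2)) * 1) ?_
  rw [ae_restrict_iff' Metric.isClosed_closedBall.measurableSet]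
  refine Filter.Eventually.of_forall fun x hx => ?_
  have hx' : ‖x‖ ≤ τ := by simpa using hx
  rw [Real.norm_of_nonneg (waveWeight_nonneg τ x)]
  refine (waveWeight_le hn hτ hx').trans ?_
  have : Real.exp (-((τ - ‖x‖) / 2)) ≤ 1 := Real.exp_le_one_iff.2 (by linarith)
  have h0 : 0 < τ := by linarith
  gcongr

/-- The weight has size `τ^(-(n-1)/2)` on a layer of bounded thickness at the sphere of radius `τ`,
whose volume is of order `τ^(n-1)`. -/
theorem exists_integral_waveWeight_rpow_le (hn : 1 ≤ n) {r : ℝ} (hr : 0 < r) :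
    ∃ C : ℝ, 0 < C ∧ ∀ τ : ℝ, 1 ≤ τ →
      (∫ x in Metric.closedBall (0 : EuclideanSpace ℝ (Fin n)) τ, waveWeight τ x ^ r) ≤
        C * τ ^ (((n : ℝ) - 1) * (1 - r / 2)) := by
  set c₀ : ℝ := Real.exp (1 / 8) * 5 * (8 * Real.pi) ^ ((n : ℝ) / 2) with hc₀
  set c₁ : ℝ := n * volume.real (Metric.ball (0 : EuclideanSpace ℝ (Fin n)) 1) / (r / 2) with hc₁
  have hv : 0 < volume.real (Metric.ball (0 : EuclideanSpace ℝ (Fin n)) 1) :=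
    ENNReal.toReal_pos (Metric.measure_ball_pos _ _ one_pos).ne' measure_ball_lt_top.ne
  have hn0 : (0 : ℝ) < n := by exact_mod_cast hn
  have hc₀p : 0 < c₀ := by positivity
  refine ⟨c₀ ^ r * c₁, by positivity, fun τ hτ => ?_⟩
  have hτ0 : 0 < τ := by linarith
  have h1 : (∫ x in Metric.closedBall (0 : EuclideanSpace ℝ (Fin n)) τ, waveWeight τ x ^ r) ≤
      ∫ x in Metric.closedBall (0 : EuclideanSpace ℝ (Fin n)) τ,
        (c₀ * τ ^ (-(((n : ℝ) - 1) / 2))) ^ r * Real.exp (-(r / 2 * (τ - ‖x‖))) := by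
    apply integral_mono_of_nonneg
    · exact Filter.Eventually.of_forall fun x => Real.rpow_nonneg (waveWeight_nonneg τ x) r
    · exact (ContinuousOn.integrableOn_compact (isCompact_closedBall _ _) (by fun_prop))
    · rw [Filter.EventuallyLE, ae_restrict_iff' Metric.isClosed_closedBall.measurableSet]
      refine Filter.Eventually.of_forall fun x hx => ?_
      have h2 := Real.rpow_le_rpow (waveWeight_nonneg τ x)
        (waveWeight_le hn hτ (x := x) (by simpa using hx)) hr.le
      refine h2.trans_eq ?_
      rw [Real.mul_rpow (by positivity) (by positivity), ← Real.exp_mul]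
      congr 2
      ring
  rw [integral_const_mul] at h1
  refine h1.trans ((mul_le_mul_of_nonneg_left
    (integral_exp_radial_le hn (by positivity) hτ0) (by positivity)).trans_eq ?_)
  rw [← hc₁, Real.mul_rpow hc₀p.le (by positivity), ← Real.rpow_mul hτ0.le]
  have : τ ^ (((n : ℝ) - 1) * (1 - r / 2))
      = τ ^ (-(((n : ℝ) - 1) / 2) * r) * τ ^ ((n : ℝ) - 1) := by
    rw [← Real.rpow_add hτ0]; congr 1; ring
  rw [this]
  ring

theorem volume_shell_pos (hn : 1 ≤ n) : 0 < volume.real (shell n) := by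
  apply ENNReal.toReal_pos _ isCompact_shell.measure_lt_top.ne
  obtain ⟨e, he, -⟩ := exists_unit_vector hn (0 : EuclideanSpace ℝ (Fin n))
  have hsub : Metric.ball ((3 / 2 : ℝ) • e) (1 / 2) ⊆ shell n := by
    intro ξ hξ
    rw [Metric.mem_ball, dist_eq_norm] at hξ
    have h1 : ‖(3 / 2 : ℝ) • e‖ = 3 / 2 := by rw [norm_smul, he]; norm_num
    have h2 := abs_norm_sub_norm_le ξ ((3 / 2 : ℝ) • e)
    rw [h1] at h2
    obtain ⟨h3, h4⟩ := abs_le.1 (h2.trans hξ.le)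
    exact ⟨by linarith, by linarith⟩
  exact ((Metric.measure_ball_pos volume _ (by norm_num)).trans_le (measure_mono hsub)).ne'

/-! ### Truncated exponential weights and the tested equation -/

/-- The exponential `exp (ξ·x)`, truncated by a bump function around the origin. -/
noncomputable def expWeight (χ : ContDiffBump (0 : EuclideanSpace ℝ (Fin n)))
    (ξ x : EuclideanSpace ℝ (Fin n)) : ℝ := χ x * Real.exp (inner ℝ ξ x)

section ExpWeight

variable (χ : ContDiffBump (0 : EuclideanSpace ℝ (Fin n))) (ξ : EuclideanSpace ℝ (Fin n))

theorem contDiff_expWeight : ContDiff ℝ ∞ (expWeight χ ξ) :=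
  χ.contDiff.mul (contDiff_const.inner ℝ contDiff_id).exp

theorem continuous_expWeight : Continuous (expWeight χ ξ) := (contDiff_expWeight χ ξ).continuous

theorem hasCompactSupport_expWeight : HasCompactSupport (expWeight χ ξ) :=
  χ.hasCompactSupport.mul_right

theorem expWeight_nonneg (x : EuclideanSpace ℝ (Fin n)) : 0 ≤ expWeight χ ξ x :=
  mul_nonneg χ.nonneg (Real.exp_pos _).le

theorem expWeight_of_norm_le {x : EuclideanSpace ℝ (Fin n)} (hx : ‖x‖ ≤ χ.rIn) :
    expWeight χ ξ x = Real.exp (inner ℝ ξ x) := by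
  rw [expWeight, χ.one_of_mem_closedBall (by simpa using hx), one_mul]

theorem expWeight_of_le_norm {x : EuclideanSpace ℝ (Fin n)} (hx : χ.rOut ≤ ‖x‖) :
    expWeight χ ξ x = 0 := by
  rw [expWeight, χ.zero_of_le_dist (by simpa using hx), zero_mul]

theorem memLp_expWeight (p : ℝ≥0∞) : MemLp (expWeight χ ξ) p volume :=
  (continuous_expWeight χ ξ).memLp_of_hasCompactSupport (hasCompactSupport_expWeight χ ξ)

end ExpWeight

/-! ### Integration by parts against the truncated exponential. -/

/-- The partial derivative in the `i`-th coordinate direction. -/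
noncomputable def pderiv (i : Fin n) (ψ : EuclideanSpace ℝ (Fin n) → ℝ)
    (x : EuclideanSpace ℝ (Fin n)) : ℝ := fderiv ℝ ψ x (EuclideanSpace.single i 1)

theorem gradient_apply (ψ : EuclideanSpace ℝ (Fin n) → ℝ) (x : EuclideanSpace ℝ (Fin n))
    (i : Fin n) : gradient ψ x i = pderiv i ψ x := by
  rw [pderiv, ← inner_gradient_left, EuclideanSpace.inner_single_right]
  simp

theorem contDiff_pderiv {ψ : EuclideanSpace ℝ (Fin n) → ℝ} (hψ : ContDiff ℝ ∞ ψ) (i : Fin n) :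
    ContDiff ℝ ∞ (pderiv i ψ) :=
  (hψ.fderiv_right (m := ∞) (by simp)).clm_apply contDiff_const

theorem hasCompactSupport_pderiv {ψ : EuclideanSpace ℝ (Fin n) → ℝ} (hψ : HasCompactSupport ψ)
    (i : Fin n) : HasCompactSupport (pderiv i ψ) :=
  hψ.fderiv_apply (𝕜 := ℝ) _

theorem integral_mul_pderiv {f : L2 n} {g : L2Vec n} (h : HasWeakGradient f g)
    {φ : EuclideanSpace ℝ (Fin n) → ℝ} (hφ : ContDiff ℝ ∞ φ) (hc : HasCompactSupport φ)
    (i : Fin n) : ∫ x, f x * pderiv i φ x = -∫ x, φ x * g x i := by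
  have h1 := congrArg (EuclideanSpace.proj (𝕜 := ℝ) i) (h φ hφ hc)
  rw [map_neg, ← ContinuousLinearMap.integral_comp_comm _ (integrable_smul_gradient f hφ hc),
    ← ContinuousLinearMap.integral_comp_comm _ (integrable_smul_vec g hφ hc)] at h1
  simpa [gradient_apply] using h1

theorem integrable_coord_mul (g : L2Vec n) {φ : EuclideanSpace ℝ (Fin n) → ℝ}
    (hφ : ContDiff ℝ ∞ φ) (hc : HasCompactSupport φ) (i : Fin n) :
    Integrable fun x => φ x * g x i := by
  have := (EuclideanSpace.proj (𝕜 := ℝ) i).integrable_comp (integrable_smul_vec g hφ hc)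
  simpa using this

theorem integrable_mul_smooth (f : L2 n) {φ : EuclideanSpace ℝ (Fin n) → ℝ}
    (hφ : Continuous φ) (hc : HasCompactSupport φ) : Integrable fun x => f x * φ x :=
  ((Lp.memLp f).locallyIntegrable (by norm_num)).integrable_smul_right_of_hasCompactSupport hφ hc

theorem integral_inner_grad {f : L2 n} {g : L2Vec n} (h : HasWeakGradient f g)
    {ψ : EuclideanSpace ℝ (Fin n) → ℝ} (hψ : ContDiff ℝ ∞ ψ) (hc : HasCompactSupport ψ) :
    ∫ x, inner ℝ (g x) (gradient ψ x) = -∫ x, f x * ∑ i, pderiv i (pderiv i ψ) x := by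
  have e1 : ∀ x, inner ℝ (g x) (gradient ψ x) = ∑ i, pderiv i ψ x * g x i := fun x => by
    rw [PiLp.inner_apply]
    refine Finset.sum_congr rfl fun i _ => ?_
    rw [gradient_apply]
    simp
  have e2 : ∀ x, f x * ∑ i, pderiv i (pderiv i ψ) x = ∑ i, f x * pderiv i (pderiv i ψ) x :=
    fun x => Finset.mul_sum _ _ _
  simp only [e1, e2]
  rw [integral_finsetSum _ fun i _ => integrable_coord_mul g (contDiff_pderiv hψ i)
      (hasCompactSupport_pderiv hc i) i,
    integral_finsetSum _ fun i _ => integrable_mul_smooth f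
      (contDiff_pderiv (contDiff_pderiv hψ i) i).continuous
      (hasCompactSupport_pderiv (hasCompactSupport_pderiv hc i) i), ← Finset.sum_neg_distrib]
  refine Finset.sum_congr rfl fun i _ => ?_
  rw [integral_mul_pderiv h (contDiff_pderiv hψ i) (hasCompactSupport_pderiv hc i) i, neg_neg]

theorem pderiv_congr {ψ ψ' : EuclideanSpace ℝ (Fin n) → ℝ} {x : EuclideanSpace ℝ (Fin n)}
    (h : ψ =ᶠ[nhds x] ψ') (i : Fin n) : pderiv i ψ =ᶠ[nhds x] pderiv i ψ' := by
  filter_upwards [h.fderiv (𝕜 := ℝ)] with y hy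
  rw [pderiv, pderiv, hy]

theorem pderiv_const_mul_exp (c : ℝ) (ξ : EuclideanSpace ℝ (Fin n)) (i : Fin n) :
    pderiv i (fun x => c * Real.exp (inner ℝ ξ x)) =
      fun x => c * ξ i * Real.exp (inner ℝ ξ x) := by
  funext x
  have h1 : HasFDerivAt (fun x => inner ℝ ξ x) (innerSL ℝ ξ) x := (innerSL ℝ ξ).hasFDerivAt
  have h2 := (h1.exp.const_mul c)
  rw [pderiv, h2.fderiv]
  simp [EuclideanSpace.inner_single_right]
  ring

theorem laplacian_expWeight (χ : ContDiffBump (0 : EuclideanSpace ℝ (Fin n)))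
    (ξ : EuclideanSpace ℝ (Fin n)) {x : EuclideanSpace ℝ (Fin n)} (hx : ‖x‖ < χ.rIn) :
    ∑ i, pderiv i (pderiv i (expWeight χ ξ)) x = ‖ξ‖ ^ 2 * expWeight χ ξ x := by
  have h1 : expWeight χ ξ =ᶠ[nhds x] fun x => 1 * Real.exp (inner ℝ ξ x) := by
    filter_upwards [χ.eventuallyEq_one_of_mem_ball (x := x) (by simpa using hx)] with y hy
    rw [expWeight, hy, Pi.one_apply]
  have h2 : ∀ i, pderiv i (pderiv i (expWeight χ ξ)) x = ξ i ^ 2 * expWeight χ ξ x := by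
    intro i
    rw [(pderiv_congr (pderiv_congr h1 i) i).eq_of_nhds, pderiv_const_mul_exp,
      pderiv_const_mul_exp, h1.eq_of_nhds]
    ring
  simp only [h2]
  rw [← Finset.sum_mul, EuclideanSpace.real_norm_sq_eq]

/-- On the support of `w` the bump function is locally one, and `exp (ξ·x)` is an eigenfunction of
the Laplacian with eigenvalue `|ξ|²`. -/
theorem integral_inner_grad_expWeight {w : H1 n} {r : ℝ}
    (χ : ContDiffBump (0 : EuclideanSpace ℝ (Fin n))) (ξ : EuclideanSpace ℝ (Fin n))
    (hr : r < χ.rIn) (hw : SupportedInBall r (H1.toL2 w)) :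
    ∫ x, inner ℝ (H1.grad w x) (gradient (expWeight χ ξ) x) =
      -(‖ξ‖ ^ 2 * ∫ x, H1.toL2 w x * expWeight χ ξ x) := by
  have hgrad : HasWeakGradient (H1.toL2 w) (H1.grad w) := w.2
  rw [integral_inner_grad hgrad (contDiff_expWeight χ ξ) (hasCompactSupport_expWeight χ ξ),
    ← integral_const_mul, neg_inj]
  apply integral_congr_ae
  filter_upwards [hw] with x hx
  by_cases hxr : ‖x‖ < χ.rIn
  · rw [laplacian_expWeight χ ξ hxr]
    ring
  · have h0 := hx (by linarith [not_lt.1 hxr])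
    rw [h0]
    ring

/-! ### Testing the weak equation with a product of cutoffs in time and space. -/

theorem exists_time_cutoff {T : EReal} {T' : ℝ} (hT' : T' ∈ timeInterval T) :
    ∃ θ : ContDiffBump (0 : ℝ), T' < θ.rIn ∧ (θ.rOut : EReal) < T := by
  obtain ⟨T₂, h1, h2⟩ := EReal.lt_iff_exists_real_btwn.1 hT'.2
  have h1' : T' < T₂ := by exact_mod_cast h1
  have h0 := hT'.1
  exact ⟨⟨(T' + T₂) / 2, T₂, by linarith, by linarith⟩, by simp only; linarith, h2⟩

theorem isTestFunction_mul {T : EReal} {θ : ContDiffBump (0 : ℝ)} (hθ : (θ.rOut : EReal) < T)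
    {ψ : EuclideanSpace ℝ (Fin n) → ℝ} (hψ : ContDiff ℝ ∞ ψ) (hc : HasCompactSupport ψ) :
    IsTestFunction T fun z : ℝ × EuclideanSpace ℝ (Fin n) => θ z.1 * ψ z.2 := by
  have hsupp : Function.support (fun z : ℝ × EuclideanSpace ℝ (Fin n) => θ z.1 * ψ z.2) ⊆
      Metric.closedBall 0 θ.rOut ×ˢ tsupport ψ := by
    intro z hz
    have h1 : θ z.1 ≠ 0 := left_ne_zero_of_mul hz
    have h2 : ψ z.2 ≠ 0 := right_ne_zero_of_mul hz
    refine ⟨?_, subset_tsupport _ h2⟩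
    have : z.1 ∈ Function.support θ := h1
    rw [θ.support_eq] at this
    exact Metric.ball_subset_closedBall this
  have hK : IsCompact (Metric.closedBall (0 : ℝ) θ.rOut ×ˢ tsupport ψ) :=
    (isCompact_closedBall _ _).prod hc
  have ht : tsupport (fun z : ℝ × EuclideanSpace ℝ (Fin n) => θ z.1 * ψ z.2) ⊆
      Metric.closedBall 0 θ.rOut ×ˢ tsupport ψ := closure_minimal hsupp hK.isClosed
  refine ⟨(θ.contDiff.comp contDiff_fst).mul (hψ.comp contDiff_snd),
    hK.of_isClosed_subset (isClosed_tsupport _) ht, fun z hz => ?_⟩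
  have h1 : ‖z.1‖ ≤ θ.rOut := by simpa using (ht hz).1
  have h2 : z.1 ≤ θ.rOut := (le_abs_self _).trans h1
  exact lt_of_le_of_lt (by exact_mod_cast h2) hθ

/-- The weak equation tested with a truncated exponential. -/
theorem WeakIdentity.tested {T : EReal} {b : ℝ → ℝ} {r : ℝ} {w1 : L2 n} {w : ℝ → H1 n}
    {wt f : ℝ → L2 n} (h : WeakIdentity T b r w1 w wt f) {T' R : ℝ} (hT' : T' ∈ timeInterval T)
    (χ : ContDiffBump (0 : EuclideanSpace ℝ (Fin n))) (hχ : T' + R < χ.rIn)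
    (hsupp : ∀ t ∈ timeInterval T, SupportedInBall (t + R) (H1.toL2 (w t)))
    (ξ : EuclideanSpace ℝ (Fin n)) {t : ℝ} (ht : t ∈ Icc 0 T') :
    (∫ x, wt t x * expWeight χ ξ x) = (∫ x, w1 x * expWeight χ ξ x)
      + ‖ξ‖ ^ 2 * (∫ s in (0 : ℝ)..t, ∫ x, H1.toL2 (w s) x * expWeight χ ξ x)
      - (∫ s in (0 : ℝ)..t, b s * ∫ x, wt s x * expWeight χ ξ x)
      + ∫ s in (0 : ℝ)..t, ∫ x, |f s x| ^ r * expWeight χ ξ x := by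
  obtain ⟨θ, hθ1, hθ2⟩ := exists_time_cutoff hT'
  have hin : ∀ s ∈ Icc 0 T', s ∈ timeInterval T := fun s hs =>
    ⟨hs.1, lt_of_le_of_lt (by exact_mod_cast hs.2) hT'.2⟩
  have hball : ∀ s ∈ Icc 0 T', s ∈ Metric.ball (0 : ℝ) θ.rIn := fun s hs => by
    rw [mem_ball_zero_iff, Real.norm_of_nonneg hs.1]
    linarith [hs.2]
  have hθ : ∀ s ∈ Icc 0 T', θ s = 1 := fun s hs =>
    θ.one_of_mem_closedBall (Metric.ball_subset_closedBall (hball s hs))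
  have hsub : uIcc 0 t ⊆ Icc 0 T' := by
    rw [uIcc_of_le ht.1]; exact Icc_subset_Icc_right ht.2
  have key := h _ (isTestFunction_mul hθ2 (contDiff_expWeight χ ξ)
    (hasCompactSupport_expWeight χ ξ)) t (hin t ht)
  simp only at key
  -- The time cutoff is one on a neighbourhood of `[0, T']`, so the term with the time derivative of
  -- the test function disappears.
  have e1 : (∫ s in (0 : ℝ)..t, ∫ x, wt s x * deriv (fun τ => θ τ * expWeight χ ξ x) s) = 0 := by
    rw [intervalIntegral.integral_congr (g := fun _ => 0), intervalIntegral.integral_zero]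
    intro s hs
    have hd : ∀ x, deriv (fun τ => θ τ * expWeight χ ξ x) s = 0 := fun x => by
      have : (fun τ => θ τ * expWeight χ ξ x) =ᶠ[nhds s] fun _ => expWeight χ ξ x := by
        filter_upwards [θ.eventuallyEq_one_of_mem_ball (hball s (hsub hs))] with τ hτ
        rw [hτ, Pi.one_apply, one_mul]
      rw [this.deriv_eq, deriv_const]
    simp [hd]
  have e2 : (∫ s in (0 : ℝ)..t, ∫ x, inner ℝ (H1.grad (w s) x)
      (gradient (fun y => θ s * expWeight χ ξ y) x))
      = -(‖ξ‖ ^ 2 * (∫ s in (0 : ℝ)..t, ∫ x, H1.toL2 (w s) x * expWeight χ ξ x)) := by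
    rw [← intervalIntegral.integral_const_mul, ← intervalIntegral.integral_neg]
    apply intervalIntegral.integral_congr
    intro s hs
    have hs' := hsub hs
    simp only [hθ s hs', one_mul]
    exact integral_inner_grad_expWeight χ ξ (by linarith [hs'.2]) (hsupp s (hin s hs'))
  have e3 : (∫ s in (0 : ℝ)..t, ∫ x, b s * wt s x * (θ s * expWeight χ ξ x))
      = ∫ s in (0 : ℝ)..t, b s * ∫ x, wt s x * expWeight χ ξ x := by
    apply intervalIntegral.integral_congr
    intro s hs
    simp only [hθ s (hsub hs), one_mul, mul_assoc, integral_const_mul]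
  have e4 : (∫ s in (0 : ℝ)..t, ∫ x, |f s x| ^ r * (θ s * expWeight χ ξ x))
      = ∫ s in (0 : ℝ)..t, ∫ x, |f s x| ^ r * expWeight χ ξ x := by
    apply intervalIntegral.integral_congr
    intro s hs
    simp only [hθ s (hsub hs), one_mul]
  rw [e1, e2, e3, e4] at key
  simp only [hθ t ht, hθ 0 ⟨le_rfl, ht.1.trans ht.2⟩, one_mul] at key
  linarith

/-! ### Pairings of an energy curve with truncated exponentials -/

/-- The pairing of an `L²` function with a truncated exponential. -/
noncomputable def pairing (χ : ContDiffBump (0 : EuclideanSpace ℝ (Fin n)))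
    (ξ : EuclideanSpace ℝ (Fin n)) (f : L2 n) : ℝ := ∫ x, f x * expWeight χ ξ x

/-- The integral of `|f|^r` against a truncated exponential. -/
noncomputable def powerPairing (r : ℝ) (χ : ContDiffBump (0 : EuclideanSpace ℝ (Fin n)))
    (ξ : EuclideanSpace ℝ (Fin n)) (f : L2 n) : ℝ := ∫ x, |f x| ^ r * expWeight χ ξ x

theorem powerPairing_nonneg (r : ℝ) (χ : ContDiffBump (0 : EuclideanSpace ℝ (Fin n)))
    (ξ : EuclideanSpace ℝ (Fin n)) (f : L2 n) : 0 ≤ powerPairing r χ ξ f :=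
  integral_nonneg fun x => mul_nonneg (Real.rpow_nonneg (abs_nonneg _) r) (expWeight_nonneg χ ξ x)

/-- Exhibits the pairing as a continuous linear functional on `L²`, so that continuity and time
derivatives of energy curves pass through it. -/
theorem pairing_eq_inner (χ : ContDiffBump (0 : EuclideanSpace ℝ (Fin n)))
    (ξ : EuclideanSpace ℝ (Fin n)) (f : L2 n) :
    pairing χ ξ f = innerSL ℝ ((memLp_expWeight χ ξ 2).toLp _) f := by
  rw [innerSL_apply_apply, L2.inner_def, pairing]
  apply integral_congr_ae
  filter_upwards [(memLp_expWeight χ ξ 2).coeFn_toLp] with x hx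
  rw [hx]
  simp

theorem pairing_nonneg (χ : ContDiffBump (0 : EuclideanSpace ℝ (Fin n)))
    (ξ : EuclideanSpace ℝ (Fin n)) {f : L2 n} (hf : Nonneg f) : 0 ≤ pairing χ ξ f :=
  integral_nonneg_of_ae (by
    filter_upwards [hf] with x hx
    exact mul_nonneg hx (expWeight_nonneg χ ξ x))

theorem memLrLoc_ae_integrableOn {T : EReal} {r T' : ℝ} {f : ℝ → L2 n} (hr : 0 < r)
    (h : MemLrLoc T r f) (hT' : T' ∈ timeInterval T) (ρ : ℝ) :
    ∀ᵐ s, s ∈ Icc 0 T' → IntegrableOn (fun x => |f s x| ^ r) (Metric.closedBall 0 ρ) := by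
  obtain ⟨W, hW, hK⟩ := h
  have hsub : Icc 0 T' ⊆ timeInterval T := fun s hs =>
    ⟨hs.1, lt_of_le_of_lt (by exact_mod_cast hs.2) hT'.2⟩
  have hm := hK (Icc 0 T' ×ˢ Metric.closedBall 0 ρ) (isCompact_Icc.prod (isCompact_closedBall _ _))
    (prod_mono hsub (subset_univ _))
  have hi := hm.integrable_norm_rpow (by simpa using hr) ENNReal.ofReal_ne_top
  rw [ENNReal.toReal_ofReal hr.le, Measure.volume_eq_prod, ← Measure.prod_restrict] at hi
  have h1 := (ae_restrict_iff' measurableSet_Icc).1 hi.prod_right_ae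
  filter_upwards [h1, hW] with s hs hWs hmem
  refine (hs hmem).congr (ae_restrict_of_ae ?_)
  filter_upwards [hWs (hsub hmem)] with x hx
  rw [hx, Real.norm_eq_abs]

theorem memLrLoc_intervalIntegrable {T : EReal} {r T' : ℝ} {f : ℝ → L2 n} (hr : 0 < r)
    (h : MemLrLoc T r f) (hT' : T' ∈ timeInterval T)
    (χ : ContDiffBump (0 : EuclideanSpace ℝ (Fin n))) (ξ : EuclideanSpace ℝ (Fin n)) :
    IntervalIntegrable (fun s => powerPairing r χ ξ (f s)) volume 0 T' := by
  obtain ⟨W, hW, hK⟩ := h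
  have hsub : Icc 0 T' ⊆ timeInterval T := fun s hs =>
    ⟨hs.1, lt_of_le_of_lt (by exact_mod_cast hs.2) hT'.2⟩
  have hm := hK (Icc 0 T' ×ˢ Metric.closedBall 0 χ.rOut)
    (isCompact_Icc.prod (isCompact_closedBall _ _)) (prod_mono hsub (subset_univ _))
  have hi := hm.integrable_norm_rpow (by simpa using hr) ENNReal.ofReal_ne_top
  rw [ENNReal.toReal_ofReal hr.le, Measure.volume_eq_prod, ← Measure.prod_restrict] at hi
  obtain ⟨C, hC⟩ := (hasCompactSupport_expWeight χ ξ).exists_bound_of_continuous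
    (continuous_expWeight χ ξ)
  have hi2 := hi.mul_bdd (c := C) (g := fun z : ℝ × EuclideanSpace ℝ (Fin n) => expWeight χ ξ z.2)
    ((continuous_expWeight χ ξ).comp continuous_snd).aestronglyMeasurable
    (Filter.Eventually.of_forall fun z => hC z.2)
  have hi3 := hi2.integral_prod_left
  rw [intervalIntegrable_iff_integrableOn_Icc_of_le hT'.1]
  refine hi3.congr ((ae_restrict_iff' measurableSet_Icc).2 ?_)
  -- Joint measurability is available only for the representative `W`, which agrees with `f` on
  -- almost every time slice; Fubini is applied to `W` and transferred.
  filter_upwards [hW] with s hWs hmem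
  rw [powerPairing, ← setIntegral_eq_integral_of_forall_compl_eq_zero
    (s := Metric.closedBall 0 χ.rOut) (μ := volume) (f := fun x => |f s x| ^ r * expWeight χ ξ x)]
  · apply integral_congr_ae
    apply ae_restrict_of_ae
    filter_upwards [hWs (hsub hmem)] with x hx
    rw [hx, Real.norm_eq_abs]
  · intro x hx
    have : χ.rOut < ‖x‖ := by simpa using hx
    rw [expWeight_of_le_norm χ ξ this.le, mul_zero]

/-- One of the two equations of the system, on `[0, T)`, with a real time `T' < T` and a bump
function equal to one on the support of the solution up to time `T'`. -/
structure Component (T : EReal) (T' R r : ℝ) (b : ℝ → ℝ)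
    (χ : ContDiffBump (0 : EuclideanSpace ℝ (Fin n))) (w1 : L2 n) (w : ℝ → H1 n)
    (wt f : ℝ → L2 n) : Prop where
  one_lt : 1 < r
  mem : T' ∈ timeInterval T
  curve : IsEnergyCurve T w wt
  weak : WeakIdentity T b r w1 w wt f
  loc : MemLrLoc T r f
  supp : ∀ t ∈ timeInterval T, SupportedInBall (t + R) (H1.toL2 (w t))
  lt_rIn : T' + R < χ.rIn
  b_cont : ContinuousOn b (Ici 0)
  b_nonneg : ∀ t, 0 ≤ t → 0 ≤ b t

theorem continuous_damping_extend {b : ℝ → ℝ} (hb : ContinuousOn b (Ici 0)) :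
    Continuous fun t => b (max t 0) :=
  hb.comp_continuous (by fun_prop) fun t => le_max_right t 0

/-- Integrability of the damping makes the integrating factor bounded uniformly in time, so that
constants do not depend on the lifespan. -/
theorem factor_extend_le {b : ℝ → ℝ} (hb0 : ∀ t, 0 ≤ t → 0 ≤ b t)
    (hbi : IntegrableOn b (Ici 0)) (t : ℝ) :
    factor (fun t => b (max t 0)) t ≤ Real.exp (∫ s in Ici (0 : ℝ), b s) := by
  apply Real.exp_le_exp.2
  have hI : 0 ≤ ∫ s in Ici (0 : ℝ), b s := setIntegral_nonneg measurableSet_Ici hb0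
  rcases le_total 0 t with ht | ht
  · rw [intervalIntegral.integral_of_le ht]
    have : (∫ s in Ioc 0 t, b (max s 0)) = ∫ s in Ioc 0 t, b s :=
      setIntegral_congr_fun measurableSet_Ioc fun s hs => by rw [max_eq_left hs.1.le]
    rw [this]
    apply setIntegral_mono_set hbi
    · exact (ae_restrict_iff' measurableSet_Ici).2 (Filter.Eventually.of_forall hb0)
    · exact Filter.Eventually.of_forall fun s hs => hs.1.le
  · rw [intervalIntegral.integral_symm]
    have : 0 ≤ ∫ s in t..0, b (max s 0) :=
      intervalIntegral.integral_nonneg ht fun s _ => hb0 _ (le_max_right _ _)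
    linarith

/-! ### Scalar inequalities for a single equation. -/

namespace Component

variable {T : EReal} {T' R r : ℝ} {b : ℝ → ℝ} {χ : ContDiffBump (0 : EuclideanSpace ℝ (Fin n))}
  {w1 : L2 n} {w : ℝ → H1 n} {wt f : ℝ → L2 n}

theorem Icc_subset (C : Component T T' R r b χ w1 w wt f) : Icc 0 T' ⊆ timeInterval T := fun s hs =>
  ⟨hs.1, lt_of_le_of_lt (by exact_mod_cast hs.2) C.mem.2⟩

/-- Extends the pairings from `[0, T']` to the whole line, as a continuous `P` with primitive `Y`,
so that the scalar differential inequalities apply without one-sided derivatives at the endpoints.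
-/
theorem scalar_data (C : Component T T' R r b χ w1 w wt f) (ξ : EuclideanSpace ℝ (Fin n)) :
    ∃ P Y : ℝ → ℝ, Continuous P ∧ (∀ t, HasDerivAt Y (P t) t) ∧
      (∀ t ∈ Icc 0 T', P t = pairing χ ξ (wt t)) ∧
      (∀ t ∈ Icc 0 T', Y t = pairing χ ξ (H1.toL2 (w t))) ∧
      P 0 = pairing χ ξ w1 ∧
      ∀ t ∈ Icc 0 T', P t = P 0 + ‖ξ‖ ^ 2 * (∫ s in (0 : ℝ)..t, Y s)
        - (∫ s in (0 : ℝ)..t, b (max s 0) * P s)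
        + ∫ s in (0 : ℝ)..t, powerPairing r χ ξ (f s) := by
  have h0 : 0 ≤ T' := C.mem.1
  set Φ := innerSL ℝ ((memLp_expWeight χ ξ 2).toLp _) with hΦ
  have hPc : ContinuousOn (fun t => pairing χ ξ (wt t)) (Icc 0 T') := by
    simp only [pairing_eq_inner]
    exact Φ.continuous.comp_continuousOn (C.curve.continuousOn_deriv.mono C.Icc_subset)
  have hYd : ∀ t ∈ Icc 0 T', HasDerivWithinAt (fun t => pairing χ ξ (H1.toL2 (w t)))
      (pairing χ ξ (wt t)) (Icc 0 T') t := fun t ht => by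
    simp only [pairing_eq_inner]
    exact (Φ.hasFDerivAt.comp_hasDerivWithinAt t
      (C.curve.hasDeriv t (C.Icc_subset ht))).mono C.Icc_subset
  set P : ℝ → ℝ := fun t => pairing χ ξ (wt (max 0 (min T' t))) with hP
  have hPe : ∀ t ∈ Icc 0 T', P t = pairing χ ξ (wt t) := fun t ht => by
    simp only [hP]
    rw [min_eq_right ht.2, max_eq_right ht.1]
  have hPcont : Continuous P := hPc.comp_continuous (by fun_prop) fun t =>
    ⟨le_max_left _ _, max_le h0 (min_le_left _ _)⟩
  set Y : ℝ → ℝ := fun t => pairing χ ξ (H1.toL2 (w 0)) + ∫ s in (0 : ℝ)..t, P s with hY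
  have hYe : ∀ t ∈ Icc 0 T', Y t = pairing χ ξ (H1.toL2 (w t)) := by
    intro t ht
    have hsub : Icc 0 t ⊆ Icc 0 T' := Icc_subset_Icc_right ht.2
    have := intervalIntegral.integral_eq_sub_of_hasDeriv_right_of_le (f' := P) ht.1
      (fun s hs => (hYd s (hsub hs)).continuousWithinAt.mono hsub)
      (fun s hs => by
        have hs' : s ∈ Ioo 0 T' := ⟨hs.1, hs.2.trans_le ht.2⟩
        rw [hPe s (Ioo_subset_Icc_self hs')]
        exact ((hYd s (Ioo_subset_Icc_self hs')).hasDerivAt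
          (Icc_mem_nhds hs'.1 hs'.2)).hasDerivWithinAt)
      (hPcont.intervalIntegrable _ _)
    simp only [hY]
    rw [this]
    ring
  have htest : ∀ t ∈ Icc 0 T', P t = pairing χ ξ w1 + ‖ξ‖ ^ 2 * (∫ s in (0 : ℝ)..t, Y s)
        - (∫ s in (0 : ℝ)..t, b (max s 0) * P s)
        + ∫ s in (0 : ℝ)..t, powerPairing r χ ξ (f s) := by
    intro t ht
    have hsub : uIcc 0 t ⊆ Icc 0 T' := by
      rw [uIcc_of_le ht.1]; exact Icc_subset_Icc_right ht.2
    have e1 : (∫ s in (0 : ℝ)..t, Y s) = ∫ s in (0 : ℝ)..t, pairing χ ξ (H1.toL2 (w s)) :=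
      intervalIntegral.integral_congr fun s hs => hYe s (hsub hs)
    have e2 : (∫ s in (0 : ℝ)..t, b (max s 0) * P s)
        = ∫ s in (0 : ℝ)..t, b s * pairing χ ξ (wt s) :=
      intervalIntegral.integral_congr fun s hs => by
        rw [hPe s (hsub hs), max_eq_left (hsub hs).1]
    rw [hPe t ht, e1, e2]
    exact C.weak.tested C.mem χ C.lt_rIn C.supp ξ ht
  have hP0 : P 0 = pairing χ ξ w1 := by simpa using htest 0 ⟨le_rfl, h0⟩
  refine ⟨P, Y, hPcont, fun t => (hasDerivAt_primitive hPcont 0 t).const_add _, hPe, hYe, hP0, ?_⟩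
  rw [hP0]
  exact htest

/-- The case of frequency zero: the Laplacian term drops out and the nonnegative initial velocity is
discarded. -/
theorem integral_power_le (C : Component T T' R r b χ w1 w wt f) {M : ℝ}
    (hM : ∀ t, factor (fun t => b (max t 0)) t ≤ M) (hw1 : Nonneg w1) {t : ℝ} (ht : t ∈ Icc 0 T') :
    M⁻¹ * (∫ s in (0 : ℝ)..t, powerPairing r χ 0 (f s)) ≤ pairing χ 0 (wt t) := by
  obtain ⟨P, Y, hPc, hY, hPe, hYe, hP0, heq⟩ := C.scalar_data 0
  have hYc : Continuous Y := continuous_iff_continuousAt.2 fun t => (hY t).continuousAt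
  have h1 := factor_mul_ge (continuous_damping_extend C.b_cont)
    (fun t => C.b_nonneg _ (le_max_right _ _)) hPc hYc
    (memLrLoc_intervalIntegrable (by linarith [C.one_lt]) C.loc C.mem χ 0)
    (fun s => powerPairing_nonneg r χ 0 (f s)) heq ht
  have h2 : 0 ≤ P 0 := hP0 ▸ pairing_nonneg χ 0 hw1
  have h3 : 0 ≤ ∫ s in (0 : ℝ)..t, powerPairing r χ 0 (f s) :=
    intervalIntegral.integral_nonneg ht.1 fun s _ => powerPairing_nonneg r χ 0 (f s)
  simp only [norm_zero, ne_eq, OfNat.ofNat_ne_zero, not_false_eq_true, zero_pow, zero_mul,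
    add_zero] at h1
  have hf := factor_pos (fun t => b (max t 0)) t
  have hMp : 0 < M := hf.trans_le (hM t)
  have h4 : 0 ≤ P t := by
    by_contra hc
    push Not at hc
    nlinarith
  rw [← hPe t ht, inv_mul_le_iff₀ hMp]
  nlinarith [mul_le_mul_of_nonneg_right (hM t) h4]

theorem exp_lower (C : Component T T' R r b χ w1 w wt f) {M : ℝ}
    (hM : ∀ t, factor (fun t => b (max t 0)) t ≤ M) (hw1 : Nonneg w1)
    (hw0 : Nonneg (H1.toL2 (w 0))) {ξ : EuclideanSpace ℝ (Fin n)} (hξ : ξ ∈ shell n) {t : ℝ}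
    (ht2 : 2 ≤ t) (htT : t ≤ T') :
    Real.exp (-2) / (8 * M ^ 2) * (pairing χ ξ w1 + pairing χ ξ (H1.toL2 (w 0))) *
        Real.exp (‖ξ‖ * t) ≤ pairing χ ξ (wt t) ∧
    Real.exp (-2) / (8 * M ^ 2) * (pairing χ ξ w1 + pairing χ ξ (H1.toL2 (w 0))) *
        Real.exp (‖ξ‖ * t) ≤ pairing χ ξ (H1.toL2 (w t)) := by
  obtain ⟨P, Y, hPc, hY, hPe, hYe, hP0, heq⟩ := C.scalar_data ξ
  have hYc : Continuous Y := continuous_iff_continuousAt.2 fun t => (hY t).continuousAt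
  have h0 : (0 : ℝ) ∈ Icc 0 T' := ⟨le_rfl, C.mem.1⟩
  have ht : t ∈ Icc 0 T' := ⟨by linarith, htT⟩
  have h1 : ∀ t ∈ Icc 0 T', _ := fun t ht => factor_mul_ge (continuous_damping_extend C.b_cont)
    (fun t => C.b_nonneg _ (le_max_right _ _)) hPc hYc
    (memLrLoc_intervalIntegrable (by linarith [C.one_lt]) C.loc C.mem χ ξ)
    (fun s => powerPairing_nonneg r χ ξ (f s)) heq ht
  have h2 := exp_growth (T := T') hξ.1 hξ.2 (continuous_damping_extend C.b_cont)
    (fun t => C.b_nonneg _ (le_max_right _ _)) hM hPc hY (hP0 ▸ pairing_nonneg χ ξ hw1)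
    (hYe 0 h0 ▸ pairing_nonneg χ ξ hw0)
    (fun s hs => by
      have h3 : 0 ≤ ∫ τ in (0 : ℝ)..s, powerPairing r χ ξ (f τ) :=
        intervalIntegral.integral_nonneg hs.1 fun τ _ => powerPairing_nonneg r χ ξ (f τ)
      linarith [h1 s hs]) ht2 htT
  rwa [hP0, hYe 0 h0, hPe t ht, hYe t ht] at h2

/-- Restricted to `|x| > t + R`, the curve vanishes at all times in `[0, t]`, hence so does its left
derivative at `t`. At `t = 0` there is no past to differentiate from, hence `0 < t`. -/
theorem supp_deriv (C : Component T T' R r b χ w1 w wt f) {t : ℝ} (ht0 : 0 < t) (htT : t ≤ T') :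
    SupportedInBall (t + R) (wt t) := by
  have ht : t ∈ timeInterval T := C.Icc_subset ⟨ht0.le, htT⟩
  set S : Set (EuclideanSpace ℝ (Fin n)) := {x | t + R < ‖x‖} with hS
  have hSm : MeasurableSet S := (isOpen_lt continuous_const continuous_norm).measurableSet
  set Λ := LpToLpRestrictCLM (EuclideanSpace ℝ (Fin n)) ℝ ℝ volume 2 S with hΛ
  have hzero : ∀ s ∈ Icc 0 t, Λ (H1.toL2 (w s)) = 0 := by
    intro s hs
    have hs' : s ∈ timeInterval T := C.Icc_subset ⟨hs.1, hs.2.trans htT⟩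
    rw [Lp.eq_zero_iff_ae_eq_zero]
    refine (LpToLpRestrictCLM_coeFn ℝ S _).trans ((ae_restrict_iff' hSm).2 ?_)
    filter_upwards [C.supp s hs'] with x hx hxS
    exact hx (lt_of_le_of_lt (by linarith [hs.2]) hxS)
  have hd : HasDerivWithinAt (fun s => Λ (H1.toL2 (w s))) (Λ (wt t)) (Icc 0 t) t :=
    (Λ.hasFDerivAt.comp_hasDerivWithinAt t (C.curve.hasDeriv t ht)).mono
      fun s hs => C.Icc_subset ⟨hs.1, hs.2.trans htT⟩
  have hd0 : HasDerivWithinAt (fun s => Λ (H1.toL2 (w s))) 0 (Icc 0 t) t :=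
    (hasDerivWithinAt_const t (Icc 0 t) (0 : Lp ℝ 2 (volume.restrict S))).congr hzero
      (hzero t ⟨ht0.le, le_rfl⟩)
  have huniq : UniqueDiffWithinAt ℝ (Icc 0 t) t :=
    uniqueDiffOn_Icc ht0 t ⟨ht0.le, le_rfl⟩
  have h0 : Λ (wt t) = 0 := huniq.eq_deriv _ hd hd0
  rw [Lp.eq_zero_iff_ae_eq_zero] at h0
  have h1 := (LpToLpRestrictCLM_coeFn ℝ S (wt t)).symm.trans h0
  exact (ae_restrict_iff' hSm).1 h1

end Component

/-! ### Lower bounds for the nonlinear terms -/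

theorem SupportedInBall.integrable {ρ : ℝ} {g : L2 n} (hg : SupportedInBall ρ g) :
    Integrable g := by
  have h1 : IntegrableOn g (Metric.closedBall 0 ρ) :=
    ((Lp.memLp g).locallyIntegrable (by norm_num)).integrableOn_isCompact
      (isCompact_closedBall _ _)
  refine h1.integrable_of_ae_notMem_eq_zero ?_
  filter_upwards [hg] with x hx hxn
  exact hx (by simpa using hxn)

theorem SupportedInBall.setIntegral_mul {ρ : ℝ} {g : L2 n} (hg : SupportedInBall ρ g)
    (h : EuclideanSpace ℝ (Fin n) → ℝ) :
    ∫ x in Metric.closedBall 0 ρ, g x * h x = ∫ x, g x * h x := by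
  apply setIntegral_eq_integral_of_ae_compl_eq_zero
  filter_upwards [hg] with x hx hxn
  rw [hx (by simpa using hxn), zero_mul]

theorem SupportedInBall.pairing_eq {ρ : ℝ} {g : L2 n} (hg : SupportedInBall ρ g)
    {χ : ContDiffBump (0 : EuclideanSpace ℝ (Fin n))} (hρ : ρ ≤ χ.rIn)
    (ξ : EuclideanSpace ℝ (Fin n)) :
    pairing χ ξ g = ∫ x in Metric.closedBall 0 ρ, g x * Real.exp (inner ℝ ξ x) := by
  rw [hg.setIntegral_mul, pairing]
  apply integral_congr_ae
  filter_upwards [hg] with x hx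
  by_cases hxρ : ‖x‖ ≤ ρ
  · rw [expWeight_of_norm_le χ ξ (hxρ.trans hρ)]
  · rw [hx (not_le.1 hxρ), zero_mul, zero_mul]

/-- Integrability is essential: the Bochner integral on the right would be zero by convention
without it. -/
theorem setIntegral_rpow_le_powerPairing {r τ : ℝ} {g : L2 n}
    {χ : ContDiffBump (0 : EuclideanSpace ℝ (Fin n))} (hτ : τ ≤ χ.rIn)
    (hg : IntegrableOn (fun x => |g x| ^ r) (Metric.closedBall 0 χ.rOut)) :
    (∫ x in Metric.closedBall 0 τ, |g x| ^ r) ≤ powerPairing r χ 0 g := by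
  have hi : Integrable fun x => |g x| ^ r * expWeight χ 0 x := by
    rw [← integrableOn_iff_integrable_of_support_subset (s := Metric.closedBall 0 χ.rOut)]
    · obtain ⟨C, hC⟩ := (hasCompactSupport_expWeight χ 0).exists_bound_of_continuous
        (continuous_expWeight χ 0)
      exact hg.mul_bdd (c := C) (continuous_expWeight χ 0).aestronglyMeasurable
        (Filter.Eventually.of_forall hC)
    · intro x hx
      by_contra hc
      have : χ.rOut < ‖x‖ := by simpa using hc
      exact hx (by simp only [expWeight_of_le_norm χ 0 this.le, mul_zero])
  have e : (∫ x in Metric.closedBall 0 τ, |g x| ^ r)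
      = ∫ x in Metric.closedBall 0 τ, |g x| ^ r * expWeight χ 0 x := by
    apply setIntegral_congr_fun Metric.isClosed_closedBall.measurableSet
    intro x hx
    have hx' : ‖x‖ ≤ τ := by simpa using hx
    simp only
    rw [expWeight_of_norm_le χ 0 (hx'.trans hτ)]
    simp
  rw [e]
  exact setIntegral_le_integral hi (Filter.Eventually.of_forall fun x =>
    mul_nonneg (Real.rpow_nonneg (abs_nonneg _) r) (expWeight_nonneg χ 0 x))

/-- Hölder's inequality raised to the power `r`, with `r/s = r - 1`. It is used with the constant
`1` and with the wave weight. -/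
theorem abs_setIntegral_mul_rpow_le {r s τ : ℝ} (hrs : r.HolderConjugate s) {g : L2 n}
    {χ : ContDiffBump (0 : EuclideanSpace ℝ (Fin n))} (hτ : τ ≤ χ.rIn)
    (hg : IntegrableOn (fun x => |g x| ^ r) (Metric.closedBall 0 χ.rOut))
    {h : EuclideanSpace ℝ (Fin n) → ℝ}
    (hh : MemLp h (ENNReal.ofReal s) (volume.restrict (Metric.closedBall 0 τ))) :
    |∫ x in Metric.closedBall 0 τ, g x * h x| ^ r ≤
      powerPairing r χ 0 g * (∫ x in Metric.closedBall 0 τ, |h x| ^ s) ^ (r - 1) := by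
  have hr0 : 0 < r := hrs.pos
  have hgτ : IntegrableOn (fun x => |g x| ^ r) (Metric.closedBall 0 τ) :=
    hg.mono_set (Metric.closedBall_subset_closedBall (hτ.trans χ.rIn_lt_rOut.le))
  have hgL : MemLp g (ENNReal.ofReal r) (volume.restrict (Metric.closedBall 0 τ)) := by
    rw [← integrable_norm_rpow_iff (Lp.aestronglyMeasurable g).restrict (by simpa using hr0)
      ENNReal.ofReal_ne_top, ENNReal.toReal_ofReal hr0.le]
    exact hgτ
  have h1 := integral_mul_norm_le_Lp_mul_Lq hrs hgL hh
  have h2 : |∫ x in Metric.closedBall 0 τ, g x * h x|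
      ≤ ∫ x in Metric.closedBall 0 τ, ‖g x‖ * ‖h x‖ := by
    rw [← Real.norm_eq_abs]
    refine (norm_integral_le_integral_norm _).trans_eq ?_
    simp only [norm_mul]
  have hA : 0 ≤ ∫ x in Metric.closedBall 0 τ, ‖g x‖ ^ r := integral_nonneg fun x => by positivity
  have hB : 0 ≤ ∫ x in Metric.closedBall 0 τ, ‖h x‖ ^ s := integral_nonneg fun x => by positivity
  have h3 := Real.rpow_le_rpow (abs_nonneg _) (h2.trans h1) hr0.le
  rw [Real.mul_rpow (by positivity) (by positivity), ← Real.rpow_mul hA, ← Real.rpow_mul hB,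
    one_div_mul_cancel hr0.ne', Real.rpow_one] at h3
  have e : 1 / s * r = r - 1 := by
    rw [hrs.conjugate_eq]
    have := hrs.sub_one_pos
    field_simp
  rw [e] at h3
  exact h3.trans (mul_le_mul_of_nonneg_right (setIntegral_rpow_le_powerPairing hτ hg)
    (Real.rpow_nonneg hB _))

theorem exists_powerPairing_ge_mean {r : ℝ} (hr : 1 < r) (n : ℕ) :
    ∃ c : ℝ, 0 < c ∧ ∀ (T R : ℝ) (χ : ContDiffBump (0 : EuclideanSpace ℝ (Fin n))) (g : L2 n),
      0 < T → 0 < R → R ≤ T → T + R < χ.rIn → SupportedInBall (T + R) g →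
      IntegrableOn (fun x => |g x| ^ r) (Metric.closedBall 0 χ.rOut) →
      c * T ^ (-((n : ℝ) * (r - 1))) * |pairing χ 0 g| ^ r ≤ powerPairing r χ 0 g := by
  set vB := volume.real (Metric.ball (0 : EuclideanSpace ℝ (Fin n)) 1) with hB1
  have hBp : 0 < vB :=
    ENNReal.toReal_pos (Metric.measure_ball_pos _ _ one_pos).ne' measure_ball_lt_top.ne
  have hrs := Real.HolderConjugate.conjExponent hr
  refine ⟨((2 ^ n * vB) ^ (r - 1))⁻¹, by positivity, ?_⟩
  intro T R χ g hT hR hRT hχ hsupp hg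
  have : IsFiniteMeasure
      (volume.restrict (Metric.closedBall (0 : EuclideanSpace ℝ (Fin n)) (T + R))) :=
    ⟨by simpa using measure_closedBall_lt_top⟩
  have h1 := abs_setIntegral_mul_rpow_le hrs hχ.le hg (h := fun _ => 1) (memLp_const 1)
  have e1 : (∫ x in Metric.closedBall 0 (T + R), g x * 1) = pairing χ 0 g := by
    rw [hsupp.pairing_eq hχ.le]
    simp
  -- Since `R ≤ T`, the ball of radius `T + R` has volume at most that of radius `2T`.
  have e2 : (∫ x in Metric.closedBall (0 : EuclideanSpace ℝ (Fin n)) (T + R),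
      |(1 : ℝ)| ^ r.conjExponent) ≤ T ^ n * (2 ^ n * vB) := by
    rw [abs_one, Real.one_rpow, setIntegral_const, smul_eq_mul, mul_one,
      Measure.addHaar_real_closedBall volume 0 (by positivity), finrank_euclideanSpace_fin, ← hB1]
    calc (T + R) ^ n * vB ≤ (T * 2) ^ n * vB := by gcongr; linarith
      _ = _ := by rw [mul_pow]; ring
  rw [e1] at h1
  have hN := powerPairing_nonneg r χ 0 g
  have h3 : (T ^ n * (2 ^ n * vB)) ^ (r - 1)
      = T ^ ((n : ℝ) * (r - 1)) * (2 ^ n * vB) ^ (r - 1) := by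
    rw [Real.mul_rpow (by positivity) (by positivity), ← Real.rpow_natCast T,
      ← Real.rpow_mul hT.le]
  have h4 : |pairing χ 0 g| ^ r ≤ powerPairing r χ 0 g *
      (T ^ ((n : ℝ) * (r - 1)) * (2 ^ n * vB) ^ (r - 1)) := by
    rw [← h3]
    refine h1.trans (mul_le_mul_of_nonneg_left (Real.rpow_le_rpow
      (integral_nonneg fun x => by positivity) e2 (by linarith)) hN)
  rw [Real.rpow_neg hT.le, ← mul_inv, inv_mul_le_iff₀ (by positivity)]
  linarith

/-! ### Superposition over the frequency shell and the lower bound near the light cone. -/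

theorem integrable_prod_exp_phase {τ : ℝ} {g : L2 n} (hg : SupportedInBall τ g) :
    Integrable (fun z : EuclideanSpace ℝ (Fin n) × EuclideanSpace ℝ (Fin n) =>
      g z.2 * Real.exp (inner ℝ z.1 z.2 - ‖z.1‖ * τ))
      ((volume.restrict (shell n)).prod (volume.restrict (Metric.closedBall 0 τ))) := by
  have : IsFiniteMeasure (volume.restrict (shell n)) :=
    ⟨by simpa using isCompact_shell.measure_lt_top⟩
  obtain ⟨C, hC⟩ := (isCompact_shell.prod (isCompact_closedBall
    (0 : EuclideanSpace ℝ (Fin n)) τ)).exists_bound_of_continuousOn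
    (continuous_exp_phase (n := n) τ).continuousOn
  refine (hg.integrable.restrict.comp_snd _).mul_bdd (c := C)
    (continuous_exp_phase τ).aestronglyMeasurable ?_
  rw [Measure.prod_restrict,
    ae_restrict_iff' (measurableSet_shell.prod Metric.isClosed_closedBall.measurableSet)]
  exact Filter.Eventually.of_forall hC

theorem exp_mul_pairing_eq {τ : ℝ} {g : L2 n} (hg : SupportedInBall τ g)
    {χ : ContDiffBump (0 : EuclideanSpace ℝ (Fin n))} (hτ : τ ≤ χ.rIn)
    (ξ : EuclideanSpace ℝ (Fin n)) :
    Real.exp (-(‖ξ‖ * τ)) * pairing χ ξ g =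
      ∫ x in Metric.closedBall 0 τ, g x * Real.exp (inner ℝ ξ x - ‖ξ‖ * τ) := by
  rw [hg.pairing_eq hτ, ← integral_const_mul]
  congr 1 with x
  rw [sub_eq_add_neg, Real.exp_add]
  ring

theorem setIntegral_mul_waveWeight {τ : ℝ} {g : L2 n} (hg : SupportedInBall τ g)
    {χ : ContDiffBump (0 : EuclideanSpace ℝ (Fin n))} (hτ : τ ≤ χ.rIn) :
    ∫ x in Metric.closedBall 0 τ, g x * waveWeight τ x =
      ∫ ξ in shell n, Real.exp (-(‖ξ‖ * τ)) * pairing χ ξ g := by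
  simp only [exp_mul_pairing_eq hg hτ]
  rw [integral_integral_swap (integrable_prod_exp_phase hg)]
  simp only [waveWeight, integral_const_mul]

/-- By Fubini the left factor is an integral over frequencies, in which the growth `exp (|ξ| t)`
cancels `exp (-|ξ|(t+R))` up to `exp (-|ξ| R) ≥ exp (-2R)`. -/
theorem waveWeight_pairing_ge {t R k : ℝ} (hR : 0 ≤ R) (hk : 0 ≤ k) {g : L2 n}
    (hg : SupportedInBall (t + R) g) {χ : ContDiffBump (0 : EuclideanSpace ℝ (Fin n))}
    (hτ : t + R ≤ χ.rIn) (h : ∀ ξ ∈ shell n, k * Real.exp (‖ξ‖ * t) ≤ pairing χ ξ g) :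
    volume.real (shell n) * Real.exp (-(2 * R)) * k ≤
      ∫ x in Metric.closedBall 0 (t + R), g x * waveWeight (t + R) x := by
  rw [setIntegral_mul_waveWeight hg hτ]
  have hi : IntegrableOn (fun ξ => Real.exp (-(‖ξ‖ * (t + R))) * pairing χ ξ g) (shell n) := by
    simp only [exp_mul_pairing_eq hg hτ]
    exact (integrable_prod_exp_phase hg).integral_prod_left
  have h1 : (∫ _ξ in shell n, Real.exp (-(2 * R)) * k) ≤
      ∫ ξ in shell n, Real.exp (-(‖ξ‖ * (t + R))) * pairing χ ξ g := by
    apply setIntegral_mono_on (integrableOn_const isCompact_shell.measure_lt_top.ne) hi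
      measurableSet_shell
    intro ξ hξ
    have h2 := mul_le_mul_of_nonneg_left (h ξ hξ) (Real.exp_pos (-(‖ξ‖ * (t + R)))).le
    refine le_trans ?_ h2
    have h3 : Real.exp (-(2 * R)) ≤ Real.exp (-(‖ξ‖ * (t + R))) * Real.exp (‖ξ‖ * t) := by
      rw [← Real.exp_add]
      apply Real.exp_le_exp.2
      nlinarith [hξ.2]
    calc _ ≤ (Real.exp (-(‖ξ‖ * (t + R))) * Real.exp (‖ξ‖ * t)) * k := by gcongr
      _ = _ := by ring
  rw [setIntegral_const, smul_eq_mul] at h1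
  linarith

/-- Replaces `τ = t + R` by `T` whatever the sign of the exponent, which changes with `r - 2` in the
application. -/
theorem rpow_ge_of_comparable {T τ : ℝ} (a : ℝ) (hT : 0 < T) (h1 : T / 4 ≤ τ) (h2 : τ ≤ 2 * T) :
    4 ^ (-|a|) * T ^ a ≤ τ ^ a := by
  have hτ : 0 < τ := by linarith
  have e : τ ^ a = (τ / T) ^ a * T ^ a := by
    rw [← Real.mul_rpow (by positivity) hT.le, div_mul_cancel₀ _ hT.ne']
  rw [e]
  apply mul_le_mul_of_nonneg_right _ (by positivity)
  have hx1 : 1 / 4 ≤ τ / T := by rw [le_div_iff₀ hT]; linarith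
  have hx2 : τ / T ≤ 2 := by rw [div_le_iff₀ hT]; linarith
  rcases le_total 0 a with ha | ha
  · rw [abs_of_nonneg ha, Real.rpow_neg (by norm_num), ← Real.inv_rpow (by norm_num)]
    exact Real.rpow_le_rpow (by norm_num) (by linarith) ha
  · rw [abs_of_nonpos ha, neg_neg]
    exact Real.rpow_le_rpow_of_nonpos (by positivity) (by linarith) ha

theorem exists_powerPairing_ge_wave (hn : 1 ≤ n) {r R : ℝ} (hr : 1 < r) (hR : 0 < R) :
    ∃ c : ℝ, 0 < c ∧ ∀ (T t k : ℝ) (χ : ContDiffBump (0 : EuclideanSpace ℝ (Fin n))) (g : L2 n),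
      4 ≤ T → R ≤ T → t ∈ Icc (T / 4) T → 0 ≤ k → T + R < χ.rIn → SupportedInBall (t + R) g →
      IntegrableOn (fun x => |g x| ^ r) (Metric.closedBall 0 χ.rOut) →
      (∀ ξ ∈ shell n, k * Real.exp (‖ξ‖ * t) ≤ pairing χ ξ g) →
      c * k ^ r * T ^ (((n : ℝ) - 1) * (1 - r / 2)) ≤ powerPairing r χ 0 g := by
  have hrs := Real.HolderConjugate.conjExponent hr
  set s := r.conjExponent with hs
  obtain ⟨C, hC, hCle⟩ := exists_integral_waveWeight_rpow_le hn hrs.symm.pos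
  set a : ℝ := ((n : ℝ) - 1) * (1 - r / 2) with ha
  set κ : ℝ := volume.real (shell n) * Real.exp (-(2 * R)) with hκ
  have hκp : 0 < κ := mul_pos (volume_shell_pos hn) (Real.exp_pos _)
  refine ⟨κ ^ r * (C ^ (r - 1))⁻¹ * 4 ^ (-|a|), by positivity, ?_⟩
  intro T t k χ g hT4 hRT ht hk hχ hsupp hg hlow
  have hT : 0 < T := by linarith
  set τ := t + R with hτ
  have hτ1 : 1 ≤ τ := by linarith [ht.1]
  have hτ0 : 0 < τ := by linarith
  have hτχ : τ ≤ χ.rIn := by linarith [ht.2]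
  have h1 := waveWeight_pairing_ge hR.le hk hsupp hτχ hlow
  have h2 := abs_setIntegral_mul_rpow_le hrs hτχ hg (memLp_waveWeight hn (ENNReal.ofReal s) hτ1)
  simp only [abs_of_nonneg (waveWeight_nonneg τ _)] at h2
  have hN := powerPairing_nonneg r χ 0 g
  have h3 : (κ * k) ^ r ≤ powerPairing r χ 0 g * (C * τ ^ (((n : ℝ) - 1) * (1 - s / 2))) ^ (r - 1) := by
    refine le_trans (Real.rpow_le_rpow (by positivity) (h1.trans (le_abs_self _)) hrs.pos.le) ?_
    refine h2.trans (mul_le_mul_of_nonneg_left (Real.rpow_le_rpow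
      (integral_nonneg fun x => Real.rpow_nonneg (waveWeight_nonneg τ x) s) (hCle τ hτ1)
      (by linarith)) hN)
  -- Conjugacy gives `s (r - 1) = r`, so `(1 - s/2)(r - 1) = r/2 - 1`.
  have e : ((n : ℝ) - 1) * (1 - s / 2) * (r - 1) = -a := by
    rw [hrs.conjugate_eq, ha]
    have := hrs.sub_one_pos
    field_simp
    ring
  rw [Real.mul_rpow hκp.le hk, Real.mul_rpow hC.le (by positivity), ← Real.rpow_mul hτ0.le, e,
    Real.rpow_neg hτ0.le] at h3
  have h4 : κ ^ r * k ^ r * τ ^ a ≤ powerPairing r χ 0 g * C ^ (r - 1) := by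
    have hτa : 0 < τ ^ a := by positivity
    calc κ ^ r * k ^ r * τ ^ a ≤ powerPairing r χ 0 g * (C ^ (r - 1) * (τ ^ a)⁻¹) * τ ^ a := by gcongr
      _ = _ := by field_simp
  have h5 := rpow_ge_of_comparable a hT (τ := τ) (by linarith [ht.1]) (by linarith [ht.2])
  have h6 : κ ^ r * k ^ r * (4 ^ (-|a|) * T ^ a) ≤ powerPairing r χ 0 g * C ^ (r - 1) :=
    (mul_le_mul_of_nonneg_left h5 (by positivity)).trans h4
  have hCr : 0 < C ^ (r - 1) := by positivity
  calc κ ^ r * (C ^ (r - 1))⁻¹ * 4 ^ (-|a|) * k ^ r * T ^ a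
      = κ ^ r * k ^ r * (4 ^ (-|a|) * T ^ a) / C ^ (r - 1) := by field_simp
    _ ≤ powerPairing r χ 0 g := by rw [div_le_iff₀ hCr]; exact h6

theorem pairing_ge_integral {R : ℝ} {f : L2 n} (hf : Nonneg f) (hs : SupportedInBall R f)
    {χ : ContDiffBump (0 : EuclideanSpace ℝ (Fin n))} (hχ : R ≤ χ.rIn)
    {ξ : EuclideanSpace ℝ (Fin n)} (hξ : ξ ∈ shell n) :
    Real.exp (-(2 * R)) * (∫ x, f x) ≤ pairing χ ξ f := by
  rw [← integral_const_mul, pairing]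
  apply integral_mono_ae (hs.integrable.const_mul _)
    (integrable_mul_smooth f (continuous_expWeight χ ξ) (hasCompactSupport_expWeight χ ξ))
  filter_upwards [hf, hs] with x hx hxs
  by_cases hxR : ‖x‖ ≤ R
  · rw [expWeight_of_norm_le χ ξ (hxR.trans hχ), mul_comm]
    apply mul_le_mul_of_nonneg_left _ hx
    apply Real.exp_le_exp.2
    have h1 := (abs_le.1 (abs_real_inner_le_norm ξ x)).1
    have h2 : ‖ξ‖ * ‖x‖ ≤ 2 * R := mul_le_mul hξ.2 hxR (norm_nonneg _) (by norm_num)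
    linarith
  · rw [hxs (not_le.1 hxR)]
    simp

theorem integral_pos_of_nonneg {R : ℝ} {f : L2 n} (hf : Nonneg f) (hs : SupportedInBall R f)
    (hne : f ≠ 0) : 0 < ∫ x, f x := by
  refine (integral_nonneg_of_ae hf).lt_of_ne fun h0 => hne ?_
  rw [Lp.eq_zero_iff_ae_eq_zero]
  exact (integral_eq_zero_iff_of_nonneg_ae hf hs.integrable).1 h0.symm

/-! ### The averaged system of an energy solution -/

theorem nonneg_smul {ε : ℝ} (hε : 0 ≤ ε) {f : L2 n} (hf : Nonneg f) : Nonneg (ε • f) := by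
  filter_upwards [hf, Lp.coeFn_smul ε f] with x hx hs
  rw [hs, Pi.smul_apply, smul_eq_mul]
  exact mul_nonneg hε hx

theorem pairing_smul (χ : ContDiffBump (0 : EuclideanSpace ℝ (Fin n)))
    (ξ : EuclideanSpace ℝ (Fin n)) (ε : ℝ) (f : L2 n) :
    pairing χ ξ (ε • f) = ε * pairing χ ξ f := by
  rw [pairing_eq_inner, pairing_eq_inner, map_smul, smul_eq_mul]

theorem toL2_smul (ε : ℝ) (w : H1 n) : H1.toL2 (ε • w) = ε • H1.toL2 w := rfl

namespace Component

variable {T : EReal} {T' R r : ℝ} {b : ℝ → ℝ} {χ : ContDiffBump (0 : EuclideanSpace ℝ (Fin n))}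
  {w1 : L2 n} {w : ℝ → H1 n} {wt f : ℝ → L2 n}

/-- Exponential growth of the pairings, in terms of the mass `m` of the data. -/
theorem exp_lower_of_mass {ε M m : ℝ} {w0 : H1 n} (hε : 0 < ε)
    (C : Component T T' R r b χ (ε • w1) w wt f)
    (hM : ∀ t, factor (fun t => b (max t 0)) t ≤ M) (hinit : w 0 = ε • w0) (hw1 : Nonneg w1)
    (hw0 : Nonneg (H1.toL2 w0)) (hs1 : SupportedInBall R w1)
    (hs0 : SupportedInBall R (H1.toL2 w0)) (hm : m ≤ (∫ x, w1 x) + ∫ x, H1.toL2 w0 x)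
    {ξ : EuclideanSpace ℝ (Fin n)} (hξ : ξ ∈ shell n) {t : ℝ} (ht2 : 2 ≤ t) (htT : t ≤ T') :
    ε * (Real.exp (-2) / (8 * M ^ 2) * Real.exp (-(2 * R)) * m) * Real.exp (‖ξ‖ * t)
      ≤ pairing χ ξ (wt t) ∧
    ε * (Real.exp (-2) / (8 * M ^ 2) * Real.exp (-(2 * R)) * m) * Real.exp (‖ξ‖ * t)
      ≤ pairing χ ξ (H1.toL2 (w t)) := by
  have hRχ : R ≤ χ.rIn := by linarith [C.lt_rIn, C.mem.1]
  have h := C.exp_lower hM (nonneg_smul hε.le hw1)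
    (by rw [hinit, toL2_smul]; exact nonneg_smul hε.le hw0) hξ ht2 htT
  rw [hinit, toL2_smul, pairing_smul, pairing_smul, ← mul_add] at h
  have h1 := pairing_ge_integral hw1 hs1 hRχ hξ
  have h0 := pairing_ge_integral hw0 hs0 hRχ hξ
  have h2 : Real.exp (-(2 * R)) * m ≤ pairing χ ξ w1 + pairing χ ξ (H1.toL2 w0) := by
    have := mul_le_mul_of_nonneg_left hm (Real.exp_pos (-(2 * R))).le
    linarith
  have h3 : ε * (Real.exp (-2) / (8 * M ^ 2) * Real.exp (-(2 * R)) * m) * Real.exp (‖ξ‖ * t)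
      ≤ Real.exp (-2) / (8 * M ^ 2) * (ε * (pairing χ ξ w1 + pairing χ ξ (H1.toL2 w0))) *
        Real.exp (‖ξ‖ * t) := by
    calc _ = Real.exp (-2) / (8 * M ^ 2) * (ε * (Real.exp (-(2 * R)) * m)) *
          Real.exp (‖ξ‖ * t) := by ring
      _ ≤ _ := by gcongr
  exact ⟨h3.trans h.1, h3.trans h.2⟩

end Component

/-- The constant is fixed before `ε`, `T'` and the solution; this uniformity is what makes the final
bound a lifespan estimate. -/
theorem exists_averagedSystem (hn : 1 ≤ n) {p q : ℝ} (hp : 1 < p) (hq : 1 < q) {b₁ b₂ : ℝ → ℝ}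
    (hb₁c : ContinuousOn b₁ (Ici 0)) (hb₂c : ContinuousOn b₂ (Ici 0))
    (hb₁0 : ∀ t, 0 ≤ t → 0 ≤ b₁ t) (hb₂0 : ∀ t, 0 ≤ t → 0 ≤ b₂ t)
    (hb₁i : IntegrableOn b₁ (Ici 0)) (hb₂i : IntegrableOn b₂ (Ici 0)) {R : ℝ} (hR : 0 < R)
    {u₀ v₀ : H1 n} {u₁ v₁ : L2 n} (hu₀ : Nonneg (H1.toL2 u₀)) (hu₁ : Nonneg u₁)
    (hv₀ : Nonneg (H1.toL2 v₀)) (hv₁ : Nonneg v₁) (hu₀s : SupportedInBall R (H1.toL2 u₀))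
    (hu₁s : SupportedInBall R u₁) (hv₀s : SupportedInBall R (H1.toL2 v₀))
    (hv₁s : SupportedInBall R v₁) (hu₁ne : u₁ ≠ 0) (hv₀ne : H1.toL2 v₀ ≠ 0) :
    ∃ c : ℝ, 0 < c ∧ ∀ (ε T' : ℝ) (T : EReal) (u v : ℝ → H1 n), 0 < ε → 8 ≤ T' → R ≤ T' →
      T' ∈ timeInterval T → IsEnergySolution p q b₁ b₂ ε u₀ u₁ v₀ v₁ T u v →
      (∀ t ∈ timeInterval T, SupportedInBall (t + R) (H1.toL2 (u t)) ∧
        SupportedInBall (t + R) (H1.toL2 (v t))) →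
      ∃ A V W Np Nq : ℝ → ℝ, AveragedSystem n p q c ε T' A V W Np Nq := by
  set M₁ := Real.exp (∫ s in Ici (0 : ℝ), b₁ s) with hM₁
  set M₂ := Real.exp (∫ s in Ici (0 : ℝ), b₂ s) with hM₂
  have hM₁p : 0 < M₁ := Real.exp_pos _
  have hM₂p : 0 < M₂ := Real.exp_pos _
  obtain ⟨cp, hcp, Hp⟩ := exists_powerPairing_ge_mean hp n
  obtain ⟨cq, hcq, Hq⟩ := exists_powerPairing_ge_mean hq n
  obtain ⟨dp, hdp, Dp⟩ := exists_powerPairing_ge_wave hn hp hR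
  obtain ⟨dq, hdq, Dq⟩ := exists_powerPairing_ge_wave hn hq hR
  have hmu : 0 < ∫ x, u₁ x := integral_pos_of_nonneg hu₁ hu₁s hu₁ne
  have hmv : 0 < ∫ x, H1.toL2 v₀ x := integral_pos_of_nonneg hv₀ hv₀s hv₀ne
  set ku := Real.exp (-2) / (8 * M₁ ^ 2) * Real.exp (-(2 * R)) * ∫ x, u₁ x with hku
  set kv := Real.exp (-2) / (8 * M₂ ^ 2) * Real.exp (-(2 * R)) * ∫ x, H1.toL2 v₀ x with hkv
  have hkup : 0 < ku := by positivity
  have hkvp : 0 < kv := by positivity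
  obtain ⟨c, hc, h1, h2, h3, h4, h5, h6⟩ : ∃ c : ℝ, 0 < c ∧ c ≤ M₁⁻¹ ∧ c ≤ M₂⁻¹ ∧ c ≤ cp ∧
      c ≤ cq ∧ c ≤ dp * ku ^ p ∧ c ≤ dq * kv ^ q :=
    ⟨min (min (min M₁⁻¹ M₂⁻¹) (min cp cq)) (min (dp * ku ^ p) (dq * kv ^ q)), by positivity,
      by simp, by simp, by simp, by simp, by simp, by simp⟩
  refine ⟨c, hc, ?_⟩
  intro ε T' T u v hε hT8 hRT hmem ⟨ut, vt, hcu, hcv, hlu, hlv, hiu, hiv, hwu, hwv⟩ hsupp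
  have hT'0 : 0 < T' := by linarith
  -- One on the ball of radius `T' + R + 1`, which strictly contains the support of the solution up
  -- to time `T'`.
  set χ : ContDiffBump (0 : EuclideanSpace ℝ (Fin n)) :=
    ⟨T' + R + 1, T' + R + 2, by linarith, by linarith⟩ with hχ
  have hχin : T' + R < χ.rIn := by simp [hχ]
  have Cu : Component T T' R q b₁ χ (ε • u₁) u ut (fun t => H1.toL2 (v t)) :=
    ⟨hq, hmem, hcu, hwu, hlv, fun t ht => (hsupp t ht).1, hχin, hb₁c, hb₁0⟩
  have Cv : Component T T' R p b₂ χ (ε • v₁) v vt ut :=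
    ⟨hp, hmem, hcv, hwv, hlu, fun t ht => (hsupp t ht).2, hχin, hb₂c, hb₂0⟩
  have hMu := factor_extend_le hb₁0 hb₁i
  have hMv := factor_extend_le hb₂0 hb₂i
  obtain ⟨W, Y, hWc, hYd, hWe, hYe, -, -⟩ := Cv.scalar_data 0
  have hsuppu : ∀ t ∈ Icc 0 T', 0 < t → SupportedInBall (t + R) (ut t) := fun t ht ht0 =>
    Cu.supp_deriv ht0 ht.2
  have hsuppv : ∀ t ∈ Icc 0 T', SupportedInBall (t + R) (H1.toL2 (v t)) := fun t ht =>
    Cv.supp t (Cv.Icc_subset ht)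
  have enlarge : ∀ {t : ℝ} {g : L2 n}, t ≤ T' → SupportedInBall (t + R) g →
      SupportedInBall (T' + R) g := fun {t g} ht hg => by
    filter_upwards [hg] with x hx hxT
    exact hx (by linarith)
  -- The support of `ut` is controlled only at positive times; the single time zero is negligible.
  have hne : ∀ᵐ s : ℝ, s ≠ 0 := by
    have : volume {(0 : ℝ)} = 0 := by simp
    exact compl_mem_ae_iff.2 this
  refine ⟨fun t => pairing χ 0 (ut t), fun t => pairing χ 0 (H1.toL2 (v t)), W,
    fun t => powerPairing p χ 0 (ut t), fun t => powerPairing q χ 0 (H1.toL2 (v t)),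
    { A_ge := ?_, W_ge := ?_, V_ge := ?_, W_cont := hWc, Np_int := ?_, Nq_int := ?_,
      Np_nonneg := fun t => powerPairing_nonneg p χ 0 _,
      Nq_nonneg := fun t => powerPairing_nonneg q χ 0 _,
      Np_ge := ?_, Nq_ge := ?_, Np_ge' := ?_, Nq_ge' := ?_ }⟩
  · intro t ht
    refine (mul_le_mul_of_nonneg_right h1 ?_).trans
      (Cu.integral_power_le hMu (nonneg_smul hε.le hu₁) ht)
    exact intervalIntegral.integral_nonneg ht.1 fun s _ => powerPairing_nonneg q χ 0 _
  · intro t ht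
    rw [hWe t ht]
    refine (mul_le_mul_of_nonneg_right h2 ?_).trans
      (Cv.integral_power_le hMv (nonneg_smul hε.le hv₁) ht)
    exact intervalIntegral.integral_nonneg ht.1 fun s _ => powerPairing_nonneg p χ 0 _
  · intro t ht
    rw [intervalIntegral.integral_eq_sub_of_hasDerivAt (fun s _ => hYd s)
      (hWc.intervalIntegrable _ _), hYe t ht, hYe 0 ⟨le_rfl, hT'0.le⟩, hiv, toL2_smul]
    linarith [pairing_nonneg χ 0 (nonneg_smul hε.le hv₀)]
  · exact memLrLoc_intervalIntegrable (by linarith) hlu hmem χ 0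
  · exact memLrLoc_intervalIntegrable (by linarith) hlv hmem χ 0
  · filter_upwards [memLrLoc_ae_integrableOn (by linarith) hlu hmem χ.rOut, hne] with s hs hs0 hsT
    refine le_trans (by gcongr) (Hp T' R χ (ut s) hT'0 hR hRT hχin
      (enlarge hsT.2 (hsuppu s hsT (lt_of_le_of_ne hsT.1 (Ne.symm hs0)))) (hs hsT))
  · filter_upwards [memLrLoc_ae_integrableOn (by linarith) hlv hmem χ.rOut] with s hs hsT
    refine le_trans (by gcongr) (Hq T' R χ (H1.toL2 (v s)) hT'0 hR hRT hχin
      (enlarge hsT.2 (hsuppv s hsT)) (hs hsT))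
  · filter_upwards [memLrLoc_ae_integrableOn (by linarith) hlu hmem χ.rOut] with s hs hsT
    have hs0 : s ∈ Icc 0 T' := ⟨by linarith [hsT.1], hsT.2⟩
    -- The mass of `u₁` alone drives the growth of `∂ₜu`, that of `u₀` being dropped; in the next
    -- bound the mass of `v₀` plays this role for `v`. The exponential bounds need `s ≥ 2`, which
    -- follows from `s ≥ T'/4` and `T' ≥ 8`.
    have key := Dp T' s (ε * ku) χ (ut s) (by linarith) hRT hsT (by positivity) hχin
      (hsuppu s hs0 (by linarith [hsT.1])) (hs hs0) fun ξ hξ =>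
        (Cu.exp_lower_of_mass hε hMu hiu hu₁ hu₀ hu₁s hu₀s
          (le_add_of_nonneg_right (integral_nonneg_of_ae hu₀)) hξ (by linarith [hsT.1]) hsT.2).1
    refine le_trans ?_ key
    rw [Real.mul_rpow hε.le hkup.le, mul_comm (ε ^ p), ← mul_assoc]
    gcongr
  · filter_upwards [memLrLoc_ae_integrableOn (by linarith) hlv hmem χ.rOut] with s hs hsT
    have hs0 : s ∈ Icc 0 T' := ⟨by linarith [hsT.1], hsT.2⟩
    have key := Dq T' s (ε * kv) χ (H1.toL2 (v s)) (by linarith) hRT hsT (by positivity) hχin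
      (hsuppv s hs0) (hs hs0) fun ξ hξ =>
        (Cv.exp_lower_of_mass hε hMv hiv hv₁ hv₀ hv₁s hv₀s
          (le_add_of_nonneg_left (integral_nonneg_of_ae hv₁)) hξ (by linarith [hsT.1]) hsT.2).2
    refine le_trans ?_ key
    rw [Real.mul_rpow hε.le hkvp.le, mul_comm (ε ^ q), ← mul_assoc]
    gcongr

/-! ### From the averaged system to the lifespan. -/

theorem exists_lifespan_bound (ν : ℝ) {p q c : ℝ} (hp : 1 < p) (hq : 1 < q) (hc : 0 < c)
    (hΘ : 0 < max ((q + 1 + p⁻¹) / (p * q - 1) - (ν - 1) / 2)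
      ((2 + q⁻¹) / (p * q - 1) - (ν - 1) / 2)) :
    ∃ C : ℝ, 0 < C ∧ ∀ (ε T : ℝ) (A V W Np Nq : ℝ → ℝ), 0 < ε → 0 < T →
      AveragedSystem ν p q c ε T A V W Np Nq →
      T ≤ C * ε ^ (-(max ((q + 1 + p⁻¹) / (p * q - 1) - (ν - 1) / 2)
        ((2 + q⁻¹) / (p * q - 1) - (ν - 1) / 2))⁻¹) := by
  rcases max_choice ((q + 1 + p⁻¹) / (p * q - 1) - (ν - 1) / 2)
    ((2 + q⁻¹) / (p * q - 1) - (ν - 1) / 2) with h | h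
  · rw [h] at hΘ ⊢
    exact AveragedSystem.lifespan_one ν hp hq hc hΘ
  · rw [h] at hΘ ⊢
    exact AveragedSystem.lifespan_two ν hp hq hc hΘ

/-- Reduces both finiteness of `T` and its bound to real times inside the interval, where the
averaged system is available. -/
theorem lt_top_and_le_of_forall_real {T : EReal} {B : ℝ} (hB : 0 ≤ B)
    (h : ∀ t ∈ timeInterval T, t ≤ B) : T < ⊤ ∧ T ≤ (B : EReal) := by
  have hle : T ≤ (B : EReal) := by
    by_contra hc
    obtain ⟨x, hx1, hx2⟩ := EReal.lt_iff_exists_real_btwn.1 (not_le.1 hc)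
    have hx1' : B < x := by exact_mod_cast hx1
    linarith [h x ⟨hB.trans hx1'.le, hx2⟩]
  exact ⟨lt_of_le_of_lt hle (EReal.coe_lt_top B), hle⟩

end DampedWave

theorem theorem1 (n : ℕ) (hn : 1 ≤ n) (p q : ℝ) (hp : 1 < p) (hq : 1 < q)
    (hsub : ((n : ℝ) - 1) / 2 <
      max ((q + 1 + p⁻¹) / (p * q - 1)) ((2 + q⁻¹) / (p * q - 1)))
    (b₁ b₂ : ℝ → ℝ)
    (hb₁c : ContinuousOn b₁ (Set.Ici 0)) (hb₂c : ContinuousOn b₂ (Set.Ici 0))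
    (hb₁0 : ∀ t, 0 ≤ t → 0 ≤ b₁ t) (hb₂0 : ∀ t, 0 ≤ t → 0 ≤ b₂ t)
    (hb₁i : MeasureTheory.IntegrableOn b₁ (Set.Ici 0))
    (hb₂i : MeasureTheory.IntegrableOn b₂ (Set.Ici 0))
    (R : ℝ) (hR : 0 < R)
    (u₀ v₀ : DampedWave.H1 n) (u₁ v₁ : DampedWave.L2 n)
    (hu₀ : DampedWave.Nonneg (DampedWave.H1.toL2 u₀)) (hu₁ : DampedWave.Nonneg u₁)
    (hv₀ : DampedWave.Nonneg (DampedWave.H1.toL2 v₀)) (hv₁ : DampedWave.Nonneg v₁)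
    (hu₀s : DampedWave.SupportedInBall R (DampedWave.H1.toL2 u₀)) (hu₁s : DampedWave.SupportedInBall R u₁)
    (hv₀s : DampedWave.SupportedInBall R (DampedWave.H1.toL2 v₀)) (hv₁s : DampedWave.SupportedInBall R v₁)
    (hu₁ne : u₁ ≠ 0) (hv₀ne : (DampedWave.H1.toL2 v₀) ≠ 0) :
    ∃ ε₀ : ℝ, 0 < ε₀ ∧ ∃ C : ℝ, 0 < C ∧
      ∀ ε : ℝ, 0 < ε → ε ≤ ε₀ → ∀ (T : EReal), 0 < T → ∀ u v : ℝ → DampedWave.H1 n,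
        DampedWave.IsEnergySolution p q b₁ b₂ ε u₀ u₁ v₀ v₁ T u v →
        (∀ t ∈ DampedWave.timeInterval T,
          DampedWave.SupportedInBall (t + R) (DampedWave.H1.toL2 (u t)) ∧
          DampedWave.SupportedInBall (t + R) (DampedWave.H1.toL2 (v t))) →
        T < ⊤ ∧
        T ≤ ((C * ε ^ (-(max (DampedWave.Theta1 n p q) (DampedWave.Theta2 n p q))⁻¹) : ℝ) :
          EReal) := by
  have hΘ : 0 < max (DampedWave.Theta1 n p q) (DampedWave.Theta2 n p q) := by
    rw [lt_max_iff] at hsub ⊢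
    unfold DampedWave.Theta1 DampedWave.Theta2
    exact hsub.imp sub_pos.2 sub_pos.2
  obtain ⟨c, hc, hsys⟩ := DampedWave.exists_averagedSystem hn hp hq hb₁c hb₂c hb₁0 hb₂0 hb₁i hb₂i
    hR hu₀ hu₁ hv₀ hv₁ hu₀s hu₁s hv₀s hv₁s hu₁ne hv₀ne
  obtain ⟨C, hC, hlife⟩ := DampedWave.exists_lifespan_bound (n : ℝ) hp hq hc hΘ
  -- For `ε ≤ 1` the power of `ε` is at least one, so the constant `max 8 R` covers the short times
  -- at which the averaged system is not available.
  refine ⟨1, one_pos, max C (max 8 R), by positivity, ?_⟩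
  intro ε hε hε1 T _ u v hsol hsupp
  have hpow : 1 ≤ ε ^ (-(max (DampedWave.Theta1 n p q) (DampedWave.Theta2 n p q))⁻¹) :=
    Real.one_le_rpow_of_pos_of_le_one_of_nonpos hε hε1 (neg_nonpos.2 (inv_nonneg.2 hΘ.le))
  apply DampedWave.lt_top_and_le_of_forall_real (by positivity)
  intro t ht
  by_cases hlarge : max 8 R ≤ t
  · obtain ⟨h8, hRt⟩ := max_le_iff.1 hlarge
    obtain ⟨A, V, W, Np, Nq, hS⟩ := hsys ε t T u v hε h8 hRt ht hsol hsupp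
    refine (hlife ε t A V W Np Nq hε (by linarith) hS).trans ?_
    exact mul_le_mul_of_nonneg_right (le_max_left _ _) (by positivity)
  · calc t ≤ max C (max 8 R) := (not_le.1 hlarge).le.trans (le_max_right _ _)
      _ ≤ _ := le_mul_of_one_le_right (by positivity) hpow
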